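/- All graphs are finite and simple, and paths are simple (no repeated vertices). Let $P,Q$ be paths of a graph $H$. A \emph{split} of $P,Q$ is a vertex of degree at least $3$ in $P\cup Q$; write $P\sim Q$ if $P$ and $Q$ share at least one edge and have no split. For a family $\mathcal P=(P_v)_{v\in V}$ of (not necessarily distinct) paths of $H$, the graph $\mathrm{ENP}(\mathcal P)$ has vertex set $V$, and distinct $u,v$ are adjacent if and only if $P_u\sim P_v$. A graph is ENPT if it equals $\mathrm{ENP}(\mathcal P)$ for a family $\mathcal P$ of paths of a tree. It is $B_k$-ENPG if it equals $\mathrm{ENP}(\mathcal P)$ for a family $\mathcal P$ of paths of a grid graph (the Cartesian product of two path graphs), each path having at most $k$ bends, where a bend of a path is an internal vertex at which the path changes between horizontal and vertical direction. SPLIT is the class of graphs whose vertex set can be partitioned into a clique and a stable set. \textbf{Theorem.} The following strict inclusions hold: \[ B_1\text{-ENPG}\cap \mathrm{SPLIT}\subsetneq B_2\text{-ENPG}\cap \mathrm{SPLIT},\qquad B_1\text{-ENPG}\cap \mathrm{SPLIT}\subsetneq \mathrm{ENPT}\cap \mathrm{SPLIT}. \] Both are witnessed by the following graph $G$. Its vertex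 set is the disjoint union of the clique $K=\{0,1,\dots,10\}$ and a stable set $S$. The set $S$ has one vertex for every pair of elements that are consecutive in $(0,1,2,3,4,5,6,7,8,9,10)$ or in $(0,5,10,4,9,3,8,2,7,1,6)$, and one vertex for each of $\{0,2\},\{0,3\},\{0,4\}$; each vertex of $S$ is adjacent to exactly the two elements of its pair. Then $G$ is a connected split graph with $|K|=11$ and $|S|=23$; writing $S_d$ for the set of vertices of $S$ of degree $d$ in $G$, the inequality $|S_d|\le 2(|K|+2-d)$ fails for $d=2$; and $G$ is both $B_2$-ENPG and ENPT, but not $B_1$-ENPG. -/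

import Mathlib

universe u

namespace ENP

/-! ### Paths in a host graph, splits and the ENP graph of a family of paths -/

/-- A (simple) path of a graph `H`. -/
structure PathIn {W : Type*} (H : SimpleGraph W) where
  source : W
  target : W
  walk : H.Walk source target
  isPath : walk.IsPath

/-- The two paths have a common edge. -/
def EdgeIntersect {W : Type*} {H : SimpleGraph W} (P Q : PathIn H) : Prop :=
  ∃ e, e ∈ P.walk.edges ∧ e ∈ Q.walk.edges

/-- The set of splits of `P` and `Q`: the vertices that have degree at least `3` in the
union `P ∪ Q`. -/
def splits {W : Type*} {H : SimpleGraph W} (P Q : PathIn H) : Set W :=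
  {v | 3 ≤ ((P.walk.toSubgraph ⊔ Q.walk.toSubgraph).neighborSet v).ncard}

/-- `P ∼ Q`: the paths intersect in an edge and do not split. -/
def NonSplitting {W : Type*} {H : SimpleGraph W} (P Q : PathIn H) : Prop :=
  EdgeIntersect P Q ∧ splits P Q = ∅

theorem NonSplitting.symm {W : Type*} {H : SimpleGraph W} {P Q : PathIn H}
    (h : NonSplitting P Q) : NonSplitting Q P := by
  obtain ⟨⟨e, he, he'⟩, hs⟩ := h
  refine ⟨⟨e, he', he⟩, ?_⟩
  unfold splits at hs ⊢
  rw [sup_comm]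
  exact hs

/-- The graph of edge-intersecting and non-splitting paths of the family `P`. Different
vertices may be represented by the same path. -/
def enpGraph {V W : Type*} {H : SimpleGraph W} (P : V → PathIn H) : SimpleGraph V where
  Adj x y := x ≠ y ∧ NonSplitting (P x) (P y)
  symm := ⟨fun _ _ h => ⟨h.1.symm, h.2.symm⟩⟩
  loopless := ⟨fun _ h => h.1 rfl⟩

/-- The `m × n` grid graph, the Cartesian product of two path graphs. -/
abbrev grid (m n : ℕ) : SimpleGraph (Fin m × Fin n) :=
  SimpleGraph.boxProd (SimpleGraph.pathGraph m) (SimpleGraph.pathGraph n)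

/-- The bends of a path of the grid: the vertices that are incident with a horizontal edge
and with a vertical edge of the path. Such a vertex is necessarily internal. -/
def bends {m n : ℕ} (P : PathIn (grid m n)) : Set (Fin m × Fin n) :=
  {v | ∃ a b, s(a, v) ∈ P.walk.edges ∧ s(b, v) ∈ P.walk.edges ∧ a.2 = v.2 ∧ b.1 = v.1}

/-! ### Graph classes -/

/-- `G` is `B_k`-ENPG: it is the ENP graph of paths with at most `k` bends in a grid. -/
def IsBENPG {V : Type*} (k : ℕ) (G : SimpleGraph V) : Prop :=
  ∃ (m n : ℕ) (P : V → PathIn (grid m n)),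
    G = enpGraph P ∧ ∀ v, (bends (P v)).ncard ≤ k

/-- `G` is ENPT: it is the ENP graph of paths in a (finite) tree. -/
def IsENPT {V : Type*} (G : SimpleGraph V) : Prop :=
  ∃ (W : Type) (_ : Finite W) (T : SimpleGraph W) (P : V → PathIn T),
    T.IsTree ∧ G = enpGraph P

/-- `K`, `S` is a partition of the vertices of `G` into a clique and a stable set
(either one may be empty). -/
def IsSplitPartition {V : Type*} (G : SimpleGraph V) (K S : Set V) : Prop :=
  IsCompl K S ∧ G.IsClique K ∧ G.IsIndepSet S

/-- A finite simple graph. -/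
structure FinGraph : Type (u + 1) where
  V : Type u
  finite : Finite V
  graph : SimpleGraph V

/-- The class of `B_k`-ENPG graphs. -/
def BENPG (k : ℕ) : Set FinGraph.{u} := {G | IsBENPG k G.graph}

/-- The class of ENPT graphs. -/
def ENPT : Set FinGraph.{u} := {G | IsENPT G.graph}

/-- The class of split graphs. -/
def SPLIT : Set FinGraph.{u} := {G | ∃ K S : Set G.V, IsSplitPartition G.graph K S}

/-! ### The separating graph -/

/-- The unordered pairs of consecutive elements of a list. -/
def consecutivePairs {α : Type*} (l : List α) : List (Sym2 α) :=
  List.zipWith (fun a b => s(a, b)) l l.tail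

def sigmaL : List (Fin 11) := [0, 1, 2, 3, 4, 5, 6, 7, 8, 9, 10]

def sigmaR : List (Fin 11) := [0, 5, 10, 4, 9, 3, 8, 2, 7, 1, 6]

/-- The pairs that are consecutive in one of the two orders, and three more pairs. -/
def witnessPairs : Finset (Sym2 (Fin 11)) :=
  (consecutivePairs sigmaL ++ consecutivePairs sigmaR ++
    [s(0, 2), s(0, 3), s(0, 4)]).toFinset

abbrev WitnessVertex : Type := Fin 11 ⊕ {e : Sym2 (Fin 11) // e ∈ witnessPairs}

/-- The split graph with clique `{0, …, 10}` and one stable vertex for every pair in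
`witnessPairs`, adjacent to exactly the two members of the pair. -/
def witnessGraph : SimpleGraph WitnessVertex where
  Adj x y :=
    match x, y with
    | .inl i, .inl j => i ≠ j
    | .inl i, .inr e => i ∈ e.1
    | .inr e, .inl i => i ∈ e.1
    | .inr _, .inr _ => False
  symm := ⟨by
    rintro (i | e) (j | f) h
    · exact Ne.symm h
    · exact h
    · exact h
    · exact h⟩
  loopless := ⟨by
    rintro (i | e) h
    · exact h rfl
    · exact h⟩

/-- The clique of the witness. -/
def witnessK : Set WitnessVertex := Set.range Sum.inl

/-- The stable set of the witness. -/
def witnessS : Set WitnessVertex := Set.range Sum.inr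

/-- The witness as a member of the class of finite graphs. -/
def witness : FinGraph.{0} := ⟨WitnessVertex, inferInstance, witnessGraph⟩

/-- The set of the vertices of `S` that have degree `d` in `G`. -/
def ofDegree {V : Type*} (G : SimpleGraph V) (S : Set V) (d : ℕ) : Set V :=
  {s ∈ S | (G.neighborSet s).ncard = d}

end ENP

/-! Except for a single path without edges, the members of a clique of one-bend paths all pass
through one grid edge (`shareH_or_shareU`, then Helly for intervals in `exists_central`). As they do
not split, their union is a path: a stretch of a row, continued at either end by at most one column.
Each member `k` is a subpath, given by its left end `l k` and right end `r k`.

Let `P` be a further one-bend path. If `P` contains the common edge, it fits `k` exactly when `l k`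
is above one threshold and `r k` is below another. Since `P` turns on one side only, the threshold
on the other side is either void or the fixed value `A` or `B` at which the row stretch ends. If `P`
misses the common edge, it interacts with one side only, and its neighbours are the members whose
end on that side lies in an interval. These are the four alternatives of `CliqueTrace`.

Two consequences follow. Such traces are realized in a caterpillar: clique members become intervals
of the spine, stable vertices become intervals with a private leaf at one or both ends, and a leaf
attached inside a clique interval makes a split. This gives the inclusion in ENPT
(`isENPT_of_cliqueTrace`). On the other hand, two-element neighbourhoods that are intervals for `l`
number at most `|K| - 1`, likewise for `r`, and each of the two remaining types is a chain and
yields at most one pair. For `|K| = 11` this allows 22 pairs, and the witness has 23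
(`witness_not_isBENPG_one`).

The witness itself lives in a caterpillar with two leaf colours. With the spine as the middle row of
a grid with three rows and the colours above and below, each of its paths bends at most at the two
ends of its spine interval. -/

namespace ENP

/-! ### One-bend shapes in the integer grid -/

/-- A rectilinear path with at most one bend: a corner `(x, y)`, a horizontal arm that ends in
column `p`, and a vertical arm that ends in row `q`. -/
structure LShape where
  x : ℤ
  y : ℤ
  p : ℤ
  q : ℤ

namespace LShape

/-- The edge from `(i, j)` to `(i + 1, j)` belongs to the shape. -/
def H (L : LShape) (i j : ℤ) : Prop :=
  j = L.y ∧ ((L.x ≤ i ∧ i < L.p) ∨ (L.p ≤ i ∧ i < L.x))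

/-- The edge from `(i, j)` to `(i, j + 1)` belongs to the shape. -/
def U (L : LShape) (i j : ℤ) : Prop :=
  i = L.x ∧ ((L.y ≤ j ∧ j < L.q) ∨ (L.q ≤ j ∧ j < L.y))

def ShareH (P Q : LShape) : Prop := ∃ i j, P.H i j ∧ Q.H i j

def ShareU (P Q : LShape) : Prop := ∃ i j, P.U i j ∧ Q.U i j

/-- At least three of the four propositions hold. -/
def Three (a b c d : Prop) : Prop :=
  (a ∧ b ∧ c) ∨ (a ∧ b ∧ d) ∨ (a ∧ c ∧ d) ∨ (b ∧ c ∧ d)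

theorem Three.swap_left {a b c d : Prop} (h : Three a b c d) : Three b a c d := by
  unfold Three at *; tauto

theorem Three.swap_right {a b c d : Prop} (h : Three a b c d) : Three a b d c := by
  unfold Three at *; tauto

theorem Three.exchange {a b c d : Prop} (h : Three a b c d) : Three c d a b := by
  unfold Three at *; tauto

theorem Three.imp {a b c d a' b' c' d' : Prop} (h : Three a b c d) (ha : a → a') (hb : b → b')
    (hc : c → c') (hd : d → d') : Three a' b' c' d' := by
  rcases h with ⟨h1, h2, h3⟩ | ⟨h1, h2, h3⟩ | ⟨h1, h2, h3⟩ | ⟨h1, h2, h3⟩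
  · exact .inl ⟨ha h1, hb h2, hc h3⟩
  · exact .inr (.inl ⟨ha h1, hb h2, hd h3⟩)
  · exact .inr (.inr (.inl ⟨ha h1, hc h2, hd h3⟩))
  · exact .inr (.inr (.inr ⟨hb h1, hc h2, hd h3⟩))

/-- The union of the two shapes has degree at least three at `(i, j)`. -/
def SplitAt (P Q : LShape) (i j : ℤ) : Prop :=
  Three (P.H i j ∨ Q.H i j) (P.H (i - 1) j ∨ Q.H (i - 1) j)
    (P.U i j ∨ Q.U i j) (P.U i (j - 1) ∨ Q.U i (j - 1))

def Sim (P Q : LShape) : Prop := (ShareH P Q ∨ ShareU P Q) ∧ ∀ i j, ¬ SplitAt P Q i j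

theorem Sim.symm {P Q : LShape} (h : Sim P Q) : Sim Q P := by
  obtain ⟨h1, h2⟩ := h
  refine ⟨?_, fun i j h3 => h2 i j ?_⟩
  · rcases h1 with ⟨i, j, a, b⟩ | ⟨i, j, a, b⟩
    · exact .inl ⟨i, j, b, a⟩
    · exact .inr ⟨i, j, b, a⟩
  · exact Three.imp h3 Or.symm Or.symm Or.symm Or.symm

/-! ### Symmetries of the grid acting on shapes -/

/-- Exchange of the two coordinates. -/
def swap (L : LShape) : LShape := ⟨L.y, L.x, L.q, L.p⟩

/-- Translation that moves `(c, d)` to the origin. -/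
def shift (c d : ℤ) (L : LShape) : LShape := ⟨L.x - c, L.y - d, L.p - c, L.q - d⟩

/-- Reflection that exchanges the columns `0` and `1`. -/
def mirror (L : LShape) : LShape := ⟨1 - L.x, L.y, 1 - L.p, L.q⟩

/-- Reflection in the row `0`. -/
def flip (L : LShape) : LShape := ⟨L.x, -L.y, L.p, -L.q⟩

theorem H_swap (L : LShape) (i j : ℤ) : L.swap.H i j ↔ L.U j i := by
  simp only [H, U, swap]

theorem U_swap (L : LShape) (i j : ℤ) : L.swap.U i j ↔ L.H j i := by
  simp only [H, U, swap]

theorem H_shift (c d : ℤ) (L : LShape) (i j : ℤ) :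
    (L.shift c d).H i j ↔ L.H (i + c) (j + d) := by
  simp only [H, shift]; omega

theorem U_shift (c d : ℤ) (L : LShape) (i j : ℤ) :
    (L.shift c d).U i j ↔ L.U (i + c) (j + d) := by
  simp only [U, shift]; omega

theorem H_mirror (L : LShape) (i j : ℤ) : L.mirror.H i j ↔ L.H (-i) j := by
  simp only [H, mirror]; omega

theorem U_mirror (L : LShape) (i j : ℤ) : L.mirror.U i j ↔ L.U (1 - i) j := by
  simp only [U, mirror]; omega

theorem H_flip (L : LShape) (i j : ℤ) : L.flip.H i j ↔ L.H i (-j) := by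
  simp only [H, flip]; omega

theorem U_flip (L : LShape) (i j : ℤ) : L.flip.U i j ↔ L.U i (-j - 1) := by
  simp only [U, flip]; omega

theorem sim_swap {P Q : LShape} (h : Sim P Q) : Sim P.swap Q.swap := by
  obtain ⟨h1, h2⟩ := h
  refine ⟨?_, fun i j h3 => h2 j i ?_⟩
  · rcases h1 with ⟨i, j, a, b⟩ | ⟨i, j, a, b⟩
    · exact .inr ⟨j, i, (U_swap _ _ _).2 a, (U_swap _ _ _).2 b⟩
    · exact .inl ⟨j, i, (H_swap _ _ _).2 a, (H_swap _ _ _).2 b⟩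
  · simp only [SplitAt, H_swap, U_swap] at h3 ⊢
    exact h3.exchange

theorem sim_shift (c d : ℤ) {P Q : LShape} (h : Sim P Q) : Sim (P.shift c d) (Q.shift c d) := by
  obtain ⟨h1, h2⟩ := h
  refine ⟨?_, fun i j h3 => h2 (i + c) (j + d) ?_⟩
  · rcases h1 with ⟨i, j, a, b⟩ | ⟨i, j, a, b⟩
    · exact .inl ⟨i - c, j - d, by simpa [H_shift] using a, by simpa [H_shift] using b⟩
    · exact .inr ⟨i - c, j - d, by simpa [U_shift] using a, by simpa [U_shift] using b⟩
  · simpa only [SplitAt, H_shift, U_shift, sub_add_eq_add_sub] using h3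

theorem sim_mirror {P Q : LShape} (h : Sim P Q) : Sim P.mirror Q.mirror := by
  obtain ⟨h1, h2⟩ := h
  refine ⟨?_, fun i j h3 => h2 (1 - i) j ?_⟩
  · rcases h1 with ⟨i, j, a, b⟩ | ⟨i, j, a, b⟩
    · exact .inl ⟨-i, j, by simpa [H_mirror] using a, by simpa [H_mirror] using b⟩
    · exact .inr ⟨1 - i, j, by simpa [U_mirror] using a, by simpa [U_mirror] using b⟩
  · have e1 : -(i - 1) = 1 - i := by ring
    have e2 : 1 - i - 1 = -i := by ring
    simp only [SplitAt, H_mirror, U_mirror, e1, e2] at h3 ⊢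
    exact h3.swap_left

theorem sim_flip {P Q : LShape} (h : Sim P Q) : Sim P.flip Q.flip := by
  obtain ⟨h1, h2⟩ := h
  refine ⟨?_, fun i j h3 => h2 i (-j) ?_⟩
  · rcases h1 with ⟨i, j, a, b⟩ | ⟨i, j, a, b⟩
    · exact .inl ⟨i, -j, by simpa [H_flip] using a, by simpa [H_flip] using b⟩
    · exact .inr ⟨i, -j - 1, by simpa [U_flip] using a, by simpa [U_flip] using b⟩
  · have e1 : -(j - 1) - 1 = -j := by ring
    simp only [SplitAt, H_flip, U_flip, e1] at h3 ⊢
    exact h3.swap_right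

theorem sim_swap_iff {P Q : LShape} : Sim P.swap Q.swap ↔ Sim P Q :=
  ⟨fun h => sim_swap h, sim_swap⟩

theorem sim_shift_iff (c d : ℤ) {P Q : LShape} : Sim (P.shift c d) (Q.shift c d) ↔ Sim P Q := by
  refine ⟨fun h => ?_, sim_shift c d⟩
  simpa [shift] using sim_shift (-c) (-d) h

theorem sim_mirror_iff {P Q : LShape} : Sim P.mirror Q.mirror ↔ Sim P Q := by
  refine ⟨fun h => ?_, sim_mirror⟩
  simpa [mirror] using sim_mirror h

theorem sim_flip_iff {P Q : LShape} : Sim P.flip Q.flip ↔ Sim P Q := by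
  refine ⟨fun h => ?_, sim_flip⟩
  simpa [flip] using sim_flip h

/-! ### The direction of the common edges in a clique -/

/-- Two shapes with a common corner, without a split, whose vertical arms overlap: horizontal
arms point in the same direction. -/
theorem shareH_of_corner {P Q : LShape} (hx : P.x = Q.x) (hy : P.y = Q.y) (hv : ShareU P Q)
    (hs : ∀ i j, ¬ SplitAt P Q i j) (hP : P.p ≠ P.x) (hQ : Q.p ≠ Q.x) : ShareH P Q := by
  obtain ⟨i, j, a, b⟩ := hv
  have hs := hs P.x P.y
  simp only [U] at a b
  by_contra hc
  have h1 : ¬ (P.H P.x P.y ∧ Q.H P.x P.y) := fun h => hc ⟨_, _, h⟩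
  have h2 : ¬ (P.H (P.x - 1) P.y ∧ Q.H (P.x - 1) P.y) := fun h => hc ⟨_, _, h⟩
  simp only [SplitAt, Three, H, U] at hs h1 h2
  grind

theorem shareU_of_corner {P Q : LShape} (hx : P.x = Q.x) (hy : P.y = Q.y) (hv : ShareH P Q)
    (hs : ∀ i j, ¬ SplitAt P Q i j) (hP : P.q ≠ P.y) (hQ : Q.q ≠ Q.y) : ShareU P Q := by
  obtain ⟨i, j, a, b⟩ := hv
  have hs := hs P.x P.y
  simp only [H] at a b
  by_contra hc
  have h1 : ¬ (P.U P.x P.y ∧ Q.U P.x P.y) := fun h => hc ⟨_, _, h⟩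
  have h2 : ¬ (P.U P.x (P.y - 1) ∧ Q.U P.x (P.y - 1)) := fun h => hc ⟨_, _, h⟩
  simp only [SplitAt, Three, H, U] at hs h1 h2
  grind

theorem ShareH.row {P Q : LShape} (h : ShareH P Q) : P.y = Q.y ∧ P.p ≠ P.x ∧ Q.p ≠ Q.x := by
  obtain ⟨i, j, a, b⟩ := h
  simp only [H] at a b
  omega

theorem ShareU.column {P Q : LShape} (h : ShareU P Q) : P.x = Q.x ∧ P.q ≠ P.y ∧ Q.q ≠ Q.y := by
  obtain ⟨i, j, a, b⟩ := h
  simp only [U] at a b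
  omega

/-- In a family of pairwise similar shapes, the common edges can be taken to be all horizontal or
all vertical. -/
theorem shareH_or_shareU {ι : Type*} {K : Set ι} {L : ι → LShape}
    (h : ∀ a ∈ K, ∀ b ∈ K, Sim (L a) (L b)) :
    (∀ a ∈ K, ∀ b ∈ K, ShareH (L a) (L b)) ∨ (∀ a ∈ K, ∀ b ∈ K, ShareU (L a) (L b)) := by
  by_contra hc
  push Not at hc
  obtain ⟨⟨a, ha, b, hb, hab⟩, ⟨c, hc, d, hd, hcd⟩⟩ := hc
  have vab := (h a ha b hb).1.resolve_left hab
  have hcd' := (h c hc d hd).1.resolve_right hcd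
  have ab := vab.column
  have cd := hcd'.row
  have key1 : ¬ ((L a).y = (L b).y ∧ (L a).p ≠ (L a).x ∧ (L b).p ≠ (L b).x) := fun hh =>
    hab (shareH_of_corner ab.1 hh.1 vab (h a ha b hb).2 hh.2.1 hh.2.2)
  have key2 : ¬ ((L c).x = (L d).x ∧ (L c).q ≠ (L c).y ∧ (L d).q ≠ (L d).y) := fun hh =>
    hcd (shareU_of_corner hh.1 cd.1 hcd' (h c hc d hd).2 hh.2.1 hh.2.2)
  -- By `key1`, at most one of `a`, `b` can share a row with `c` or `d`. The other one shares its
  -- column with both `c` and `d`, contrary to `key2`.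
  have ac := (h a ha c hc).1.imp ShareH.row ShareU.column
  have ad := (h a ha d hd).1.imp ShareH.row ShareU.column
  have bc := (h b hb c hc).1.imp ShareH.row ShareU.column
  have bd := (h b hb d hd).1.imp ShareH.row ShareU.column
  omega

/-! ### Shapes through the central edge -/

/-- The shape contains the edge from `(0, 0)` to `(1, 0)`. -/
def Central (L : LShape) : Prop :=
  L.y = 0 ∧ ((L.x ≤ 0 ∧ 1 ≤ L.p) ∨ (L.p ≤ 0 ∧ 1 ≤ L.x))

/-- The first column of the horizontal arm. -/
def leftEnd (L : LShape) : ℤ := min L.x L.p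

/-- The signed length of the vertical arm at the left end of a central shape. -/
def leftArm (L : LShape) : ℤ := if L.x ≤ 0 then L.q else 0

/-- The distance of the left endpoint from the central edge, negated. -/
def leftDepth (L : LShape) : ℤ := L.leftEnd - |L.leftArm|

/-- The shapes do not split to the left of the central edge. -/
def LeftFit (P Q : LShape) : Prop :=
  (Q.leftEnd < P.leftEnd → P.leftArm = 0) ∧ (P.leftEnd < Q.leftEnd → Q.leftArm = 0) ∧
  (P.leftEnd = Q.leftEnd → (0 < P.leftArm → 0 ≤ Q.leftArm) ∧ (P.leftArm < 0 → Q.leftArm ≤ 0))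

theorem Central.mirror {L : LShape} (h : L.Central) : L.mirror.Central := by
  simp only [Central, LShape.mirror] at *; omega

theorem Central.flip {L : LShape} (h : L.Central) : L.flip.Central := by
  simp only [Central, LShape.flip] at *; omega

theorem leftEnd_flip (L : LShape) : L.flip.leftEnd = L.leftEnd := rfl

theorem leftArm_flip (L : LShape) : L.flip.leftArm = -L.leftArm := by
  simp only [leftArm, flip]; grind

theorem leftDepth_flip (L : LShape) : L.flip.leftDepth = L.leftDepth := by
  simp only [leftDepth, leftEnd_flip, leftArm_flip, abs_neg]

/-- The single corner lies on one side of the central edge. This is where the bound of one bend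
restricts the possible neighbourhoods. -/
theorem leftArm_or_mirror {L : LShape} (h : L.Central) :
    L.leftArm = 0 ∨ L.mirror.leftArm = 0 := by
  simp only [Central, leftArm, mirror] at *
  grind

theorem leftDepth_nonpos {L : LShape} (hL : L.Central) : L.leftDepth ≤ 0 := by
  simp only [Central, leftDepth, leftEnd, leftArm] at *
  grind

/-- A violation of the fit shows up as a split at the left end of one of the two horizontal arms, so
only these two vertices need inspection. -/
theorem leftFit_of_sim {P Q : LShape} (hP : P.Central) (hQ : Q.Central) (h : Sim P Q) :
    LeftFit P Q := by
  have h1 := h.2 P.leftEnd 0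
  have h2 := h.2 Q.leftEnd 0
  simp only [Central, leftEnd, leftArm, LeftFit, SplitAt, Three, H, U] at *
  grind

theorem not_splitAt_of_leftFit {P Q : LShape} (hP : P.Central) (hQ : Q.Central)
    (h : LeftFit P Q) {i j : ℤ} (hi : i ≤ 0) : ¬ SplitAt P Q i j := by
  simp only [Central, leftEnd, leftArm, LeftFit, SplitAt, Three, H, U] at *
  grind

/-- The central edge is shared, so only splits matter. Those in columns up to `0` are governed by
the left fit, those in later columns by the left fit of the mirror images. -/
theorem sim_iff_of_central {P Q : LShape} (hP : P.Central) (hQ : Q.Central) :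
    Sim P Q ↔ LeftFit P Q ∧ LeftFit P.mirror Q.mirror := by
  refine ⟨fun h => ⟨leftFit_of_sim hP hQ h, leftFit_of_sim hP.mirror hQ.mirror (sim_mirror h)⟩,
    fun ⟨h1, h2⟩ => ⟨.inl ⟨0, 0, ?_, ?_⟩, fun i j => ?_⟩⟩
  · simp only [Central, H] at *; omega
  · simp only [Central, H] at *; omega
  · rcases le_or_gt i 0 with hi | hi
    · exact not_splitAt_of_leftFit hP hQ h1 hi
    · have h3 := not_splitAt_of_leftFit hP.mirror hQ.mirror h2 (i := 1 - i) (j := j) (by omega)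
      contrapose! h3
      have e1 : -(1 - i) = i - 1 := by ring
      have e2 : 1 - (1 - i) = i := by ring
      have e3 : -(1 - i - 1) = i := by ring
      simp only [SplitAt, H_mirror, U_mirror, e1, e2, e3] at h3 ⊢
      exact Three.swap_left h3

/-! ### Shapes that miss the central edge -/

/-- A horizontal shape to the left of the central edge whose right end is free. -/
theorem sim_iff_of_row_left {P Q : LShape} (hQ : Q.Central) (hy : P.y = 0) (hx : P.x ≤ 0)
    (hp : P.p ≤ 0) (hne : P.x ≠ P.p) (hfree : P.p < P.x → P.q = 0) :
    Sim P Q ↔ Q.leftEnd < max P.x P.p ∧ LeftFit P Q := by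
  constructor
  · intro h
    have h1 := h.2 P.leftEnd 0
    have h2 := h.2 Q.leftEnd 0
    have h0 := h.1
    simp only [ShareH, ShareU] at h0
    simp only [Central, leftEnd, leftArm, LeftFit, SplitAt, Three, H, U] at *
    grind (splits := 40)
  · rintro ⟨h1, h2⟩
    refine ⟨.inl ⟨max P.x P.p - 1, 0, ?_, ?_⟩, fun i j => ?_⟩
    · simp only [Central, H, leftEnd] at *; omega
    · simp only [Central, H, leftEnd] at *; omega
    · simp only [Central, leftEnd, leftArm, LeftFit, SplitAt, Three, H, U] at *
      grind (splits := 40)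

/-- A shape that bends at its right end, to the left of the central edge. -/
theorem not_sim_of_bend_left {P Q : LShape} (hQ : Q.Central) (hy : P.y = 0) (hx : P.x ≤ 0)
    (hp : P.p < P.x) (hq : P.q ≠ 0) : ¬ Sim P Q := by
  intro h
  have h1 := h.2 P.x 0
  have h0 := h.1
  simp only [ShareH, ShareU] at h0
  simp only [Central, SplitAt, Three, H, U] at *
  grind (splits := 40)

/-- A shape without edges in the row of the central edge. -/
theorem not_sim_of_column {P Q : LShape} (hQ : Q.Central) (hx : P.x ≤ 0)
    (hrow : P.y = 0 → P.p = P.x) (h : P.x ≠ Q.leftEnd ∨ min P.y P.q < 0 ∨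
      (P.y ≤ P.q ∧ P.p ≠ P.x)) (hQv : 0 ≤ Q.leftArm) : ¬ Sim P Q := by
  intro hs
  have h1 := hs.2 Q.leftEnd 0
  have h2 := hs.2 P.x P.y
  have h0 := hs.1
  simp only [ShareH, ShareU] at h0
  simp only [Central, leftEnd, leftArm, SplitAt, Three, H, U] at *
  grind (splits := 40)

theorem not_sim_of_column_of_leftArm_eq_zero {P Q : LShape} (hQ : Q.Central) (hx : P.x ≤ 0)
    (hrow : P.y = 0 → P.p = P.x) (hQv : Q.leftArm = 0) : ¬ Sim P Q := by
  intro hs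
  have h0 := hs.1
  simp only [ShareH, ShareU] at h0
  simp only [Central, leftArm, H, U] at *
  grind (splits := 40)

/-- The shape must overlap the upward arm of `Q`. If it turns away at its upper end, then `Q` must
not continue past that corner. -/
theorem sim_iff_of_column {P Q : LShape} (hQ : Q.Central) (hx : P.x = Q.leftEnd)
    (hrow : P.y = 0 → P.p = P.x) (hmin : 0 ≤ min P.y P.q) (hfree : P.y ≤ P.q → P.p = P.x)
    (hQv : 0 < Q.leftArm) :
    Sim P Q ↔ P.y ≠ P.q ∧ min P.y P.q < Q.leftArm ∧ (P.p ≠ P.x → Q.leftArm ≤ P.y) := by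
  constructor
  · intro hs
    have h1 := hs.2 P.x P.y
    have h0 := hs.1
    simp only [ShareH, ShareU] at h0
    simp only [Central, leftEnd, leftArm, SplitAt, Three, H, U] at *
    grind (splits := 40)
  · rintro ⟨h0, h1, h2⟩
    refine ⟨.inr ⟨P.x, min P.y P.q, ?_, ?_⟩, fun i j => ?_⟩
    · simp only [Central, U, leftEnd, leftArm] at *; grind
    · simp only [Central, U, leftEnd, leftArm] at *; grind
    · simp only [Central, leftEnd, leftArm, SplitAt, Three, H, U] at *
      grind (splits := 40)

/-! ### Neighbourhoods in a clique of central shapes -/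

theorem abs_of_or {x : ℤ} : (0 ≤ x ∧ |x| = x) ∨ (x < 0 ∧ |x| = -x) := by
  rcases le_or_gt 0 x with h | h
  · exact .inl ⟨h, abs_of_nonneg h⟩
  · exact .inr ⟨h, abs_of_neg h⟩

/-- The facts about the left ends in a clique of central shapes: `A` is the first column. -/
structure LeftClique {ι : Type*} (K : Set ι) (L : ι → LShape) (A m : ℤ) : Prop where
  central : ∀ k ∈ K, (L k).Central
  le : ∀ k ∈ K, A ≤ (L k).leftEnd
  eq : ∀ k ∈ K, (L k).leftArm ≠ 0 → (L k).leftEnd = A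
  low : ∀ k ∈ K, m ≤ (L k).leftDepth

/-- `A` is the smallest left end. A member that turns at a later column would split from a member
starting at `A`, so all turns on the left happen in column `A`, and `leftDepth` measures positions
along a single path. -/
theorem exists_leftClique {ι : Type*} {K : Set ι} (hfin : K.Finite) (hne : K.Nonempty)
    {L : ι → LShape} (hc : ∀ k ∈ K, (L k).Central)
    (hfit : ∀ a ∈ K, ∀ b ∈ K, LeftFit (L a) (L b)) : ∃ A m, LeftClique K L A m := by
  obtain ⟨a, ha, ha'⟩ := hfin.exists_minimalFor (fun k => (L k).leftEnd) K hne
  obtain ⟨b, hb, hb'⟩ := hfin.exists_minimalFor (fun k => (L k).leftDepth) K hne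
  have hle : ∀ k ∈ K, (L a).leftEnd ≤ (L k).leftEnd := fun k hk => by
    rcases le_total (L a).leftEnd (L k).leftEnd with h | h
    · exact h
    · exact ha' hk h
  refine ⟨(L a).leftEnd, (L b).leftDepth, hc, hle, fun k hk h => ?_, fun k hk => ?_⟩
  · have := (hfit k hk a ha).1
    have := hle k hk
    by_contra hne
    exact h ((hfit k hk a ha).1 (by omega))
  · rcases le_total (L b).leftDepth (L k).leftDepth with h | h
    · exact h
    · exact hb' hk h

/-- The members of a clique that fit to a shape on the left form an up-set. -/
theorem LeftClique.exists_threshold {ι : Type*} {K : Set ι} {L : ι → LShape} {A m : ℤ}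
    (h : LeftClique K L A m) (hfit : ∀ a ∈ K, ∀ b ∈ K, LeftFit (L a) (L b)) (P : LShape) :
    ∃ a, (P.leftArm = 0 → a = A ∨ a = m) ∧
      ∀ k ∈ K, (LeftFit P (L k) ↔ a ≤ (L k).leftDepth) := by
  -- The threshold `A` selects the members without a left arm, and `m` selects all of them. Any
  -- other threshold arises only if `P` itself turns on the left, at a column beyond `A`.
  by_cases h1 : P.leftEnd < A
  · refine ⟨A, fun _ => .inl rfl, fun k hk => ?_⟩
    have := h.le k hk
    have := h.eq k hk
    have := abs_of_or (x := (L k).leftArm)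
    simp only [LeftFit, leftDepth]
    omega
  by_cases h2 : P.leftArm = 0
  · refine ⟨m, fun _ => .inr rfl, fun k hk => ?_⟩
    have := h.le k hk
    have := h.eq k hk
    have := h.low k hk
    simp only [LeftFit]
    omega
  by_cases h3 : P.leftEnd = A
  · by_cases h4 : ∃ k ∈ K, (0 < P.leftArm ∧ (L k).leftArm < 0) ∨ (P.leftArm < 0 ∧ 0 < (L k).leftArm)
    · obtain ⟨c, hc, h4⟩ := h4
      refine ⟨A, fun _ => .inl rfl, fun k hk => ?_⟩
      have := h.le k hk
      have := h.eq k hk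
      have := h.eq c hc
      have := (hfit c hc k hk).2.2
      have := abs_of_or (x := (L k).leftArm)
      simp only [LeftFit, leftDepth]
      omega
    · refine ⟨m, fun hh => absurd hh h2, fun k hk => ?_⟩
      have h5 : ¬ ((0 < P.leftArm ∧ (L k).leftArm < 0) ∨ (P.leftArm < 0 ∧ 0 < (L k).leftArm)) :=
        fun hh => h4 ⟨k, hk, hh⟩
      have := h.le k hk
      have := h.eq k hk
      have := h.low k hk
      simp only [LeftFit]
      omega
  · refine ⟨P.leftEnd, fun hh => absurd hh h2, fun k hk => ?_⟩
    have := h.le k hk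
    have := h.eq k hk
    have := abs_of_or (x := (L k).leftArm)
    simp only [LeftFit, leftDepth]
    omega

theorem LeftClique.exists_interval_of_nonneg {ι : Type*} {K : Set ι} {L : ι → LShape} {A m : ℤ}
    (h : LeftClique K L A m) (hfit : ∀ a ∈ K, ∀ b ∈ K, LeftFit (L a) (L b))
    (hpos : ∀ k ∈ K, 0 ≤ (L k).leftArm) (P : LShape) (hx : P.x ≤ 0) (hp : P.y = 0 → P.p ≤ 0) :
    ∃ a b, ∀ k ∈ K, (Sim P (L k) ↔ a ≤ (L k).leftDepth ∧ (L k).leftDepth < b) := by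
  have empty : (∀ k ∈ K, ¬ Sim P (L k)) →
      ∃ a b, ∀ k ∈ K, (Sim P (L k) ↔ a ≤ (L k).leftDepth ∧ (L k).leftDepth < b) := fun h0 =>
    ⟨0, 0, fun k hk => ⟨fun h => absurd h (h0 k hk), fun h => by omega⟩⟩
  by_cases hrow : P.y = 0 ∧ P.x ≠ P.p
  · obtain ⟨hy, hne⟩ := hrow
    by_cases hbend : P.p < P.x ∧ P.q ≠ 0
    · exact empty fun k hk => not_sim_of_bend_left (h.central k hk) hy hx hbend.1 hbend.2
    have key := fun k hk => sim_iff_of_row_left (h.central k hk) hy hx (hp hy) hne (by omega)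
    -- If `P` reaches beyond column `A`, then `leftEnd < max P.x P.p` is the same condition as
    -- `leftDepth < max P.x P.p`, because members with an arm satisfy both.
    by_cases hA : max P.x P.p ≤ A
    · refine empty fun k hk => ?_
      rw [key k hk]
      have := h.le k hk
      omega
    · obtain ⟨a, -, ha⟩ := h.exists_threshold hfit P
      refine ⟨a, max P.x P.p, fun k hk => ?_⟩
      rw [key k hk, ha k hk, and_comm]
      have := h.le k hk
      have := h.eq k hk
      have := abs_of_or (x := (L k).leftArm)
      have : (L k).leftDepth = (L k).leftEnd - |(L k).leftArm| := rfl
      omega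
  · have hrow' : P.y = 0 → P.p = P.x := by omega
    by_cases hbad : P.x ≠ A ∨ min P.y P.q < 0 ∨ (P.y ≤ P.q ∧ P.p ≠ P.x)
    · refine empty fun k hk hs => ?_
      by_cases hv : (L k).leftArm = 0
      · refine not_sim_of_column_of_leftArm_eq_zero (h.central k hk) hx hrow' hv hs
      · have := h.eq k hk hv
        exact not_sim_of_column (h.central k hk) hx hrow' (by omega) (hpos k hk) hs
    -- On the arms in column `A`, height `t` corresponds to depth `A - t`. The upper bound `m` makes
    -- the interval empty when `P` has no vertical edge, and the lower bound `m` is void.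
    · refine ⟨if P.p ≠ P.x then A - P.y else m, if P.y = P.q then m else A - min P.y P.q,
        fun k hk => ?_⟩
      have := h.low k hk
      have := h.le k hk
      have h1 := h.eq k hk
      have := abs_of_nonneg (hpos k hk)
      have : (L k).leftDepth = (L k).leftEnd - |(L k).leftArm| := rfl
      by_cases hv : (L k).leftArm = 0
      · refine iff_of_false (not_sim_of_column_of_leftArm_eq_zero (h.central k hk) hx hrow' hv) ?_
        split_ifs <;> omega
      · have := hpos k hk
        have := h1 hv
        rw [sim_iff_of_column (h.central k hk) (by omega) hrow' (by omega) (by omega) (by omega)]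
        split_ifs <;> omega

theorem LeftFit.flip {P Q : LShape} (h : LeftFit P Q) : LeftFit P.flip Q.flip := by
  simp only [LeftFit, leftArm_flip, leftEnd_flip] at *
  omega

theorem LeftClique.exists_interval {ι : Type*} {K : Set ι} {L : ι → LShape} {A m : ℤ}
    (h : LeftClique K L A m) (hfit : ∀ a ∈ K, ∀ b ∈ K, LeftFit (L a) (L b))
    (P : LShape) (hx : P.x ≤ 0) (hp : P.y = 0 → P.p ≤ 0) :
    ∃ a b, ∀ k ∈ K, (Sim P (L k) ↔ a ≤ (L k).leftDepth ∧ (L k).leftDepth < b) := by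
  by_cases hpos : ∀ k ∈ K, 0 ≤ (L k).leftArm
  · exact h.exists_interval_of_nonneg hfit hpos P hx hp
  · push Not at hpos
    obtain ⟨c, hc, hneg⟩ := hpos
    -- All arms start in column `A` and fit each other, so one downward arm forces all of them to
    -- point down or vanish. The flip reduces this to the upward case.
    have h' : LeftClique K (fun k => (L k).flip) A m :=
      ⟨fun k hk => (h.central k hk).flip, h.le, fun k hk hk' => h.eq k hk (by
        simpa only [leftArm_flip, neg_ne_zero] using hk'), fun k hk => by
        simpa only [leftDepth_flip] using h.low k hk⟩
    have := h'.exists_interval_of_nonneg (fun a ha b hb => (hfit a ha b hb).flip)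
      (fun k hk => by
        have h1 := h.eq k hk
        have h2 := h.eq c hc
        have h3 := hfit c hc k hk
        simp only [LeftFit, leftArm_flip] at *
        omega) P.flip hx (by simpa [LShape.flip] using hp)
    simpa only [leftDepth_flip, sim_flip_iff] using this

/-- A family of shapes that pairwise share a horizontal edge has a common one, which can be moved
into the central position. -/
theorem exists_central {ι : Type*} {K : Set ι} (hfin : K.Finite) (hne : K.Nonempty)
    {L : ι → LShape} (h : ∀ a ∈ K, ∀ b ∈ K, ShareH (L a) (L b)) :
    ∃ c d, ∀ k ∈ K, ((L k).shift c d).Central := by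
  obtain ⟨a, ha, ha'⟩ := hfin.exists_maximalFor (fun k => (L k).leftEnd) K hne
  -- One-dimensional Helly: the edge that starts at the largest left end lies in every horizontal
  -- arm.
  refine ⟨(L a).leftEnd, (L a).y, fun k hk => ?_⟩
  have h1 : (L k).leftEnd ≤ (L a).leftEnd := by
    rcases le_total (L k).leftEnd (L a).leftEnd with h | h
    · exact h
    · exact ha' hk h
  obtain ⟨i, j, h2, h3⟩ := h a ha k hk
  simp only [H, leftEnd, Central, shift] at *
  omega

/-- The neighbourhoods that a shape outside of a clique can have in the clique. The functions
`l` and `r` give the endpoints of the members of the clique on the union of the clique. -/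
def CliqueTrace {ι : Type*} (K : Set ι) (l r : ι → ℤ) (A B : ℤ) (N : ι → Prop) : Prop :=
  (∃ a b, ∀ k ∈ K, (N k ↔ a ≤ l k ∧ l k < b)) ∨
  (∃ a b, ∀ k ∈ K, (N k ↔ a < r k ∧ r k ≤ b)) ∨
  (∃ b, ∀ k ∈ K, (N k ↔ A ≤ l k ∧ r k ≤ b)) ∨
  (∃ a, ∀ k ∈ K, (N k ↔ a ≤ l k ∧ r k ≤ B))

theorem exists_cliqueTrace_of_central {ι : Type*} {K : Set ι} (hfin : K.Finite) (hne : K.Nonempty)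
    {L : ι → LShape} (h : ∀ a ∈ K, ∀ b ∈ K, Sim (L a) (L b)) (hc : ∀ k ∈ K, (L k).Central) :
    ∃ (l r : ι → ℤ) (A B : ℤ), (∀ k ∈ K, l k ≤ 0 ∧ 1 ≤ r k) ∧
      ∀ P : LShape, CliqueTrace K l r A B (fun k => Sim P (L k)) := by
  have hl : ∀ a ∈ K, ∀ b ∈ K, LeftFit (L a) (L b) := fun a ha b hb =>
    leftFit_of_sim (hc a ha) (hc b hb) (h a ha b hb)
  have hr : ∀ a ∈ K, ∀ b ∈ K, LeftFit (L a).mirror (L b).mirror := fun a ha b hb =>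
    leftFit_of_sim (hc a ha).mirror (hc b hb).mirror (sim_mirror (h a ha b hb))
  obtain ⟨A, m, HA⟩ := exists_leftClique hfin hne hc hl
  obtain ⟨B, n, HB⟩ := exists_leftClique (L := fun k => (L k).mirror) hfin hne
    (fun k hk => (hc k hk).mirror) hr
  refine ⟨fun k => (L k).leftDepth, fun k => 1 - (L k).mirror.leftDepth, A, 1 - B,
    fun k hk => ⟨leftDepth_nonpos (hc k hk), ?_⟩, fun P => ?_⟩
  · have := leftDepth_nonpos (hc k hk).mirror
    dsimp only
    omega
  by_cases hP : P.Central
  · obtain ⟨a, ha, ha'⟩ := HA.exists_threshold hl P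
    obtain ⟨b, hb, hb'⟩ := HB.exists_threshold hr P.mirror
    have key : ∀ k ∈ K, (Sim P (L k) ↔ a ≤ (L k).leftDepth ∧ 1 - (L k).mirror.leftDepth ≤ 1 - b) :=
      fun k hk => by
        rw [sim_iff_of_central hP (hc k hk), ha' k hk, hb' k hk]
        omega
    -- On a side where `P` does not turn, the threshold is the end of the row or void. A void one
    -- leaves a half-line for the other endpoint; its missing bound, `0 < r` or `l < 1`, holds on
    -- all of `K`.
    rcases leftArm_or_mirror hP with h0 | h0
    · rcases ha h0 with rfl | rfl
      · exact .inr (.inr (.inl ⟨1 - b, key⟩))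
      · refine .inr (.inl ⟨0, 1 - b, fun k hk => (key k hk).trans ?_⟩)
        have := HA.low k hk
        have := leftDepth_nonpos (hc k hk).mirror
        dsimp only
        omega
    · rcases hb h0 with rfl | rfl
      · exact .inr (.inr (.inr ⟨a, key⟩))
      · refine .inl ⟨a, 1, fun k hk => (key k hk).trans ?_⟩
        have := HB.low k hk
        have := leftDepth_nonpos (hc k hk)
        dsimp only
        omega
  · by_cases hx : P.x ≤ 0
    · exact .inl (HA.exists_interval hl P hx (by simp only [Central] at hP; omega))
    · obtain ⟨a, b, hab⟩ := HB.exists_interval hr P.mirror (by simp only [mirror]; omega)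
        (by simp only [Central, mirror] at *; omega)
      refine .inr (.inl ⟨1 - b, 1 - a, fun k hk => ?_⟩)
      dsimp only
      rw [← sim_mirror_iff, hab k hk]
      omega

theorem exists_cliqueTrace {ι : Type*} {K : Set ι} (hfin : K.Finite)
    {L : ι → LShape} (h : ∀ a ∈ K, ∀ b ∈ K, Sim (L a) (L b)) :
    ∃ (l r : ι → ℤ) (A B : ℤ), (∀ k ∈ K, l k ≤ 0 ∧ 1 ≤ r k) ∧
      ∀ P : LShape, CliqueTrace K l r A B (fun k => Sim P (L k)) := by
  rcases K.eq_empty_or_nonempty with rfl | hne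
  · exact ⟨0, 1, 0, 0, by simp, fun P => .inl ⟨0, 0, by simp⟩⟩
  rcases shareH_or_shareU h with hh | hu
  · obtain ⟨c, d, hc⟩ := exists_central hfin hne hh
    obtain ⟨l, r, A, B, h1, h2⟩ := exists_cliqueTrace_of_central hfin hne
      (fun a ha b hb => sim_shift c d (h a ha b hb)) hc
    exact ⟨l, r, A, B, h1, fun P => by simpa only [sim_shift_iff] using h2 (P.shift c d)⟩
  · obtain ⟨c, d, hc⟩ := exists_central (L := fun k => (L k).swap) hfin hne (fun a ha b hb => by
      obtain ⟨i, j, h1, h2⟩ := hu a ha b hb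
      exact ⟨j, i, (H_swap _ _ _).2 h1, (H_swap _ _ _).2 h2⟩)
    obtain ⟨l, r, A, B, h1, h2⟩ := exists_cliqueTrace_of_central hfin hne
      (fun a ha b hb => sim_shift c d (sim_swap (h a ha b hb))) hc
    exact ⟨l, r, A, B, h1, fun P => by
      simpa only [sim_shift_iff, sim_swap_iff] using h2 (P.swap.shift c d)⟩

end LShape

/-! ### Grid paths with at most one bend are shapes -/

/-- The edge between `(a, b)` and `(c, d)` belongs to the shape. -/
def LShape.Edge (L : LShape) (a b c d : ℤ) : Prop :=
  (b = d ∧ ((c = a + 1 ∧ L.H a b) ∨ (a = c + 1 ∧ L.H c b))) ∨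
  (a = c ∧ ((d = b + 1 ∧ L.U a b) ∨ (b = d + 1 ∧ L.U a d)))

/-- The edges of the walk are the edges of the shape. -/
def Traces {m n : ℕ} {u w : Fin m × Fin n} (p : (grid m n).Walk u w) (L : LShape) : Prop :=
  ∀ x y : Fin m × Fin n, s(x, y) ∈ p.edges ↔ L.Edge x.1 x.2 y.1 y.2

theorem exists_gridVertex {m n : ℕ} {i j : ℤ} (hi : 0 ≤ i) (hi' : i < m) (hj : 0 ≤ j)
    (hj' : j < n) : ∃ x : Fin m × Fin n, (x.1 : ℤ) = i ∧ (x.2 : ℤ) = j :=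
  ⟨(⟨i.toNat, by omega⟩, ⟨j.toNat, by omega⟩), by simp [hi], by simp [hj]⟩

theorem gridVertex_ext {m n : ℕ} {x y : Fin m × Fin n} :
    x = y ↔ (x.1 : ℤ) = y.1 ∧ (x.2 : ℤ) = y.2 := by
  rw [Prod.ext_iff, Fin.ext_iff, Fin.ext_iff]
  omega

theorem grid_adj_iff {m n : ℕ} {x y : Fin m × Fin n} : (grid m n).Adj x y ↔
    ((x.2 : ℤ) = y.2 ∧ ((y.1 : ℤ) = x.1 + 1 ∨ (x.1 : ℤ) = y.1 + 1)) ∨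
    ((x.1 : ℤ) = y.1 ∧ ((y.2 : ℤ) = x.2 + 1 ∨ (x.2 : ℤ) = y.2 + 1)) := by
  simp only [grid, SimpleGraph.boxProd_adj, SimpleGraph.pathGraph_adj, Fin.ext_iff]
  omega

theorem LShape.edge_congr {L L' : LShape} (hH : ∀ i j, L.H i j ↔ L'.H i j)
    (hU : ∀ i j, L.U i j ↔ L'.U i j) (a b c d : ℤ) : L.Edge a b c d ↔ L'.Edge a b c d := by
  simp only [LShape.Edge, hH, hU]

/-- If one of the arms is empty, then the corner can be moved. -/
theorem LShape.edge_corner {a b c d : ℤ} (h : a = c ∨ b = d) (x₁ x₂ y₁ y₂ : ℤ) :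
    LShape.Edge ⟨a, b, c, d⟩ x₁ x₂ y₁ y₂ ↔ LShape.Edge ⟨c, d, a, b⟩ x₁ x₂ y₁ y₂ := by
  refine edge_congr (fun i j => ?_) (fun i j => ?_) _ _ _ _
  · simp only [LShape.H]; omega
  · simp only [LShape.U]; omega

/-- Moving the free end by one step either lengthens the arm by one edge or shortens it. `hback`
excludes the latter. -/
theorem LShape.edge_extend_row {L : LShape} {s : ℤ} (h : s = L.p + 1 ∨ L.p = s + 1)
    (hback : ¬ L.Edge s L.y L.p L.y) (a b c d : ℤ) :
    LShape.Edge ⟨L.x, L.y, s, L.q⟩ a b c d ↔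
      ((a = s ∧ b = L.y) ∧ c = L.p ∧ d = L.y ∨ (a = L.p ∧ b = L.y) ∧ c = s ∧ d = L.y) ∨
        L.Edge a b c d := by
  have h1 : ¬ L.H (min s L.p) L.y := fun hh => hback (.inl ⟨rfl, by
    rcases h with h | h
    · rw [min_eq_right (by omega)] at hh; exact .inr ⟨h, hh⟩
    · rw [min_eq_left (by omega)] at hh; exact .inl ⟨h, hh⟩⟩)
  have h2 : ∀ i j, LShape.H ⟨L.x, L.y, s, L.q⟩ i j ↔ (i = min s L.p ∧ j = L.y) ∨ L.H i j := by
    intro i j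
    simp only [LShape.H] at h1 ⊢
    clear hback
    grind (splits := 40)
  have h3 : ∀ i j, LShape.U ⟨L.x, L.y, s, L.q⟩ i j ↔ L.U i j := fun i j => Iff.rfl
  simp only [LShape.Edge, h2, h3]
  generalize L.H a b = A, L.H c b = B, L.U a b = C, L.U a d = D
  clear h1 h2 h3 hback
  rcases h with h | h
  · grind (splits := 40)
  · grind (splits := 40)

theorem LShape.edge_extend_column {L : LShape} {s : ℤ} (h : s = L.q + 1 ∨ L.q = s + 1)
    (hback : ¬ L.Edge L.x s L.x L.q) (a b c d : ℤ) :
    LShape.Edge ⟨L.x, L.y, L.p, s⟩ a b c d ↔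
      ((a = L.x ∧ b = s) ∧ c = L.x ∧ d = L.q ∨ (a = L.x ∧ b = L.q) ∧ c = L.x ∧ d = s) ∨
        L.Edge a b c d := by
  have h1 : ¬ L.U L.x (min s L.q) := fun hh => hback (.inr ⟨rfl, by
    rcases h with h | h
    · rw [min_eq_right (by omega)] at hh; exact .inr ⟨h, hh⟩
    · rw [min_eq_left (by omega)] at hh; exact .inl ⟨h, hh⟩⟩)
  have h2 : ∀ i j, LShape.U ⟨L.x, L.y, L.p, s⟩ i j ↔ (i = L.x ∧ j = min s L.q) ∨ L.U i j := by
    intro i j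
    simp only [LShape.U] at h1 ⊢
    clear hback
    grind (splits := 40)
  have h3 : ∀ i j, LShape.H ⟨L.x, L.y, L.p, s⟩ i j ↔ L.H i j := fun i j => Iff.rfl
  simp only [LShape.Edge, h2, h3]
  generalize L.H a b = A, L.H c b = B, L.U a b = C, L.U a d = D
  clear h1 h2 h3 hback
  rcases h with h | h
  · grind (splits := 40)
  · grind (splits := 40)

/-- The last two bends of a path that traverses a row, a column, and a row again. -/
theorem exists_two_bends {m n : ℕ} {v w : Fin m × Fin n} (h1 : (v.1 : ℤ) ≠ w.1)
    (h2 : (v.2 : ℤ) ≠ w.2) : ∃ b c d e : Fin m × Fin n, v ≠ c ∧ b.1 = v.1 ∧ d.2 = c.2 ∧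
      e.1 = c.1 ∧ ∀ L : LShape, L = ⟨v.1, w.2, w.1, v.2⟩ →
        L.Edge b.1 b.2 v.1 v.2 ∧ L.Edge d.1 d.2 c.1 c.2 ∧ L.Edge e.1 e.2 c.1 c.2 := by
  have hv := v.1.2
  have hv' := v.2.2
  have hw := w.1.2
  have hw' := w.2.2
  obtain ⟨b, hb1, hb2⟩ := exists_gridVertex (m := m) (n := n) (i := v.1)
    (j := if (v.2 : ℤ) < w.2 then v.2 + 1 else v.2 - 1)
    (by omega) (by omega) (by split_ifs <;> omega) (by split_ifs <;> omega)
  obtain ⟨c, hc1, hc2⟩ := exists_gridVertex (m := m) (n := n) (i := v.1) (j := w.2)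
    (by omega) (by omega) (by omega) (by omega)
  obtain ⟨d, hd1, hd2⟩ := exists_gridVertex (m := m) (n := n)
    (i := if (v.1 : ℤ) < w.1 then v.1 + 1 else v.1 - 1) (j := w.2)
    (by split_ifs <;> omega) (by split_ifs <;> omega) (by omega) (by omega)
  obtain ⟨e, he1, he2⟩ := exists_gridVertex (m := m) (n := n) (i := v.1)
    (j := if (v.2 : ℤ) < w.2 then w.2 - 1 else w.2 + 1)
    (by omega) (by omega) (by split_ifs <;> omega) (by split_ifs <;> omega)
  refine ⟨b, c, d, e, ?_, by rw [Fin.ext_iff]; omega, by rw [Fin.ext_iff]; omega,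
    by rw [Fin.ext_iff]; omega, ?_⟩
  · rw [Ne, gridVertex_ext]; omega
  · rintro L rfl
    simp only [LShape.Edge, LShape.H, LShape.U]
    refine ⟨?_, ?_, ?_⟩ <;> split_ifs at * <;> omega

/-- The last two bends of a path that traverses a column, a row, and a column again. -/
theorem exists_two_bends' {m n : ℕ} {v w : Fin m × Fin n} (h1 : (v.1 : ℤ) ≠ w.1)
    (h2 : (v.2 : ℤ) ≠ w.2) : ∃ b c d e : Fin m × Fin n, v ≠ c ∧ b.2 = v.2 ∧ d.1 = c.1 ∧
      e.2 = c.2 ∧ ∀ L : LShape, L = ⟨w.1, v.2, v.1, w.2⟩ →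
        L.Edge b.1 b.2 v.1 v.2 ∧ L.Edge d.1 d.2 c.1 c.2 ∧ L.Edge e.1 e.2 c.1 c.2 := by
  have hv := v.1.2
  have hv' := v.2.2
  have hw := w.1.2
  have hw' := w.2.2
  obtain ⟨b, hb1, hb2⟩ := exists_gridVertex (m := m) (n := n) (j := v.2)
    (i := if (v.1 : ℤ) < w.1 then v.1 + 1 else v.1 - 1)
    (by split_ifs <;> omega) (by split_ifs <;> omega) (by omega) (by omega)
  obtain ⟨c, hc1, hc2⟩ := exists_gridVertex (m := m) (n := n) (i := w.1) (j := v.2)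
    (by omega) (by omega) (by omega) (by omega)
  obtain ⟨d, hd1, hd2⟩ := exists_gridVertex (m := m) (n := n) (i := w.1)
    (j := if (v.2 : ℤ) < w.2 then v.2 + 1 else v.2 - 1)
    (by omega) (by omega) (by split_ifs <;> omega) (by split_ifs <;> omega)
  obtain ⟨e, he1, he2⟩ := exists_gridVertex (m := m) (n := n) (j := v.2)
    (i := if (v.1 : ℤ) < w.1 then w.1 - 1 else w.1 + 1)
    (by split_ifs <;> omega) (by split_ifs <;> omega) (by omega) (by omega)
  refine ⟨b, c, d, e, ?_, by rw [Fin.ext_iff]; omega, by rw [Fin.ext_iff]; omega,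
    by rw [Fin.ext_iff]; omega, ?_⟩
  · rw [Ne, gridVertex_ext]; omega
  · rintro L rfl
    simp only [LShape.Edge, LShape.H, LShape.U]
    refine ⟨?_, ?_, ?_⟩ <;> split_ifs at * <;> omega

theorem exists_traces {m n : ℕ} {u w : Fin m × Fin n} (p : (grid m n).Walk u w)
    (hp : p.IsPath)
    (hb : ∀ v a b v' a' b' : Fin m × Fin n, s(a, v) ∈ p.edges → s(b, v) ∈ p.edges → a.2 = v.2 →
      b.1 = v.1 → s(a', v') ∈ p.edges → s(b', v') ∈ p.edges → a'.2 = v'.2 → b'.1 = v'.1 → v = v') :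
    Traces p ⟨w.1, u.2, u.1, w.2⟩ ∨ Traces p ⟨u.1, w.2, w.1, u.2⟩ := by
  induction p with
  | nil =>
    left
    intro x y
    refine ⟨fun h => by simp at h, fun h => ?_⟩
    simp only [LShape.Edge, LShape.H, LShape.U] at h
    omega
  | @cons u v w h p ih =>
    rw [SimpleGraph.Walk.cons_isPath_iff] at hp
    have hback : s(u, v) ∉ p.edges := fun hh => hp.2 (p.fst_mem_support_of_mem_edges hh)
    have ih := ih hp.1 fun c a b c' a' b' h1 h2 h3 h4 h1' h2' h3' h4' =>
      hb c a b c' a' b' (by simp [h1]) (by simp [h2]) h3 h4 (by simp [h1']) (by simp [h2']) h3' h4'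
    have hmem : ∀ x y, s(x, y) ∈ (SimpleGraph.Walk.cons h p).edges ↔
        (((x.1 : ℤ) = u.1 ∧ (x.2 : ℤ) = u.2) ∧ (y.1 : ℤ) = v.1 ∧ (y.2 : ℤ) = v.2 ∨
        ((x.1 : ℤ) = v.1 ∧ (x.2 : ℤ) = v.2) ∧ (y.1 : ℤ) = u.1 ∧ (y.2 : ℤ) = u.2) ∨
          s(x, y) ∈ p.edges := fun x y => by
      simp only [SimpleGraph.Walk.edges_cons, List.mem_cons, Sym2.eq_iff, gridVertex_ext]
    have huv : s(u, v) ∈ (SimpleGraph.Walk.cons h p).edges := by simp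
    rcases grid_adj_iff.1 h with ⟨h1, h2⟩ | ⟨h1, h2⟩
    · left
      -- After a horizontal first edge the rest must have its corner in the row of `v`. Otherwise it
      -- leaves `v` vertically and, unless one arm is empty and the corner can be moved, the whole
      -- path bends at `v` and again at the corner of the rest.
      have key : Traces p ⟨w.1, v.2, v.1, w.2⟩ := by
        rcases ih with hT | hT
        · exact hT
        by_cases hne : (w.1 : ℤ) = v.1 ∨ (v.2 : ℤ) = w.2
        · exact fun x y => (hT x y).trans (LShape.edge_corner hne _ _ _ _).symm
        · push Not at hne
          obtain ⟨b, c, d, e, hvc, hbv, hdc, hec, hL⟩ := exists_two_bends (Ne.symm hne.1) hne.2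
          obtain ⟨e1, e2, e3⟩ := hL _ rfl
          exact absurd (hb v u b c d e huv ((hmem _ _).2 (.inr ((hT _ _).2 e1)))
            (by rw [Fin.ext_iff]; omega) hbv ((hmem _ _).2 (.inr ((hT _ _).2 e2)))
            ((hmem _ _).2 (.inr ((hT _ _).2 e3))) hdc hec) hvc
      intro x y
      rw [hmem, key x y]
      rw [key, h1] at hback
      rw [h1]
      exact (LShape.edge_extend_row (by dsimp only; omega) hback _ _ _ _).symm
    · right
      have key : Traces p ⟨v.1, w.2, w.1, v.2⟩ := by
        rcases ih with hT | hT
        · by_cases hne : (w.1 : ℤ) = v.1 ∨ (v.2 : ℤ) = w.2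
          · exact fun x y => (hT x y).trans (LShape.edge_corner hne _ _ _ _)
          · push Not at hne
            obtain ⟨b, c, d, e, hvc, hbv, hdc, hec, hL⟩ := exists_two_bends' (Ne.symm hne.1) hne.2
            obtain ⟨e1, e2, e3⟩ := hL _ rfl
            exact absurd (hb v b u c e d ((hmem _ _).2 (.inr ((hT _ _).2 e1))) huv
              hbv (by rw [Fin.ext_iff]; omega) ((hmem _ _).2 (.inr ((hT _ _).2 e3)))
              ((hmem _ _).2 (.inr ((hT _ _).2 e2))) hec hdc) hvc
        · exact hT
      intro x y
      rw [hmem, key x y]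
      rw [key, h1] at hback
      rw [h1]
      exact (LShape.edge_extend_column (by dsimp only; omega) hback _ _ _ _).symm

/-! ### Splits of grid paths as splits of shapes -/

theorem mem_splits_iff {W : Type*} {H : SimpleGraph W} {P Q : PathIn H} {v : W} :
    v ∈ splits P Q ↔
      3 ≤ {w | s(v, w) ∈ P.walk.edges ∨ s(v, w) ∈ Q.walk.edges}.ncard := by
  simp only [splits, Set.mem_ofPred_eq, SimpleGraph.Subgraph.neighborSet, SimpleGraph.Subgraph.sup_adj,
    SimpleGraph.Walk.adj_toSubgraph_iff_mem_edges]

/-- The shape lies inside the grid. -/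
def LShape.Inside (m n : ℕ) (L : LShape) : Prop :=
  (0 ≤ L.x ∧ L.x < m) ∧ (0 ≤ L.y ∧ L.y < n) ∧ (0 ≤ L.p ∧ L.p < m) ∧ (0 ≤ L.q ∧ L.q < n)

theorem LShape.Inside.of_H {m n : ℕ} {L : LShape} (h : L.Inside m n) {i j : ℤ} (hH : L.H i j) :
    0 ≤ i ∧ i + 1 < m ∧ 0 ≤ j ∧ j < n := by
  simp only [LShape.Inside, LShape.H] at *; omega

theorem LShape.Inside.of_U {m n : ℕ} {L : LShape} (h : L.Inside m n) {i j : ℤ} (hU : L.U i j) :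
    0 ≤ i ∧ i < m ∧ 0 ≤ j ∧ j + 1 < n := by
  simp only [LShape.Inside, LShape.U] at *; omega

theorem exists_shape {m n : ℕ} (P : PathIn (grid m n)) (h : (bends P).ncard ≤ 1) :
    ∃ L : LShape, L.Inside m n ∧ Traces P.walk L := by
  have h0 := (Set.ncard_le_one (Set.toFinite _)).1 h
  have hu := P.source.1.2
  have hu' := P.source.2.2
  have hw := P.target.1.2
  have hw' := P.target.2.2
  rcases exists_traces P.walk P.isPath fun v a b v' a' b' h1 h2 h3 h4 h1' h2' h3' h4' =>
    h0 v ⟨a, b, h1, h2, h3, h4⟩ v' ⟨a', b', h1', h2', h3', h4'⟩ with hT | hT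
  · exact ⟨_, by simp only [LShape.Inside]; omega, hT⟩
  · exact ⟨_, by simp only [LShape.Inside]; omega, hT⟩

/-- The neighbour of a vertex in the union of two shapes in one of the four directions. -/
theorem edge_direction {L M : LShape} {a b c d : ℤ} (h : L.Edge a b c d ∨ M.Edge a b c d) :
    (c = a + 1 ∧ d = b ∧ (L.H a b ∨ M.H a b)) ∨
    (c = a - 1 ∧ d = b ∧ (L.H (a - 1) b ∨ M.H (a - 1) b)) ∨
    (c = a ∧ d = b + 1 ∧ (L.U a b ∨ M.U a b)) ∨
    (c = a ∧ d = b - 1 ∧ (L.U a (b - 1) ∨ M.U a (b - 1))) := by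
  rcases h with (⟨rfl, ⟨rfl, h⟩ | ⟨rfl, h⟩⟩ | ⟨rfl, ⟨rfl, h⟩ | ⟨rfl, h⟩⟩) |
    (⟨rfl, ⟨rfl, h⟩ | ⟨rfl, h⟩⟩ | ⟨rfl, ⟨rfl, h⟩ | ⟨rfl, h⟩⟩) <;> simp [h]

theorem three_of_directions {v a b c : ℤ × ℤ} {e w n s : Prop} (hab : a ≠ b) (hac : a ≠ c)
    (hbc : b ≠ c)
    (ha : (a = (v.1 + 1, v.2) ∧ e) ∨ (a = (v.1 - 1, v.2) ∧ w) ∨ (a = (v.1, v.2 + 1) ∧ n) ∨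
      (a = (v.1, v.2 - 1) ∧ s))
    (hb : (b = (v.1 + 1, v.2) ∧ e) ∨ (b = (v.1 - 1, v.2) ∧ w) ∨ (b = (v.1, v.2 + 1) ∧ n) ∨
      (b = (v.1, v.2 - 1) ∧ s))
    (hc : (c = (v.1 + 1, v.2) ∧ e) ∨ (c = (v.1 - 1, v.2) ∧ w) ∨ (c = (v.1, v.2 + 1) ∧ n) ∨
      (c = (v.1, v.2 - 1) ∧ s)) : LShape.Three e w n s := by
  unfold LShape.Three
  rcases ha with ⟨rfl, ha⟩ | ⟨rfl, ha⟩ | ⟨rfl, ha⟩ | ⟨rfl, ha⟩ <;>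
  rcases hb with ⟨rfl, hb⟩ | ⟨rfl, hb⟩ | ⟨rfl, hb⟩ | ⟨rfl, hb⟩ <;>
  rcases hc with ⟨rfl, hc⟩ | ⟨rfl, hc⟩ | ⟨rfl, hc⟩ | ⟨rfl, hc⟩ <;>
  simp_all

/-- Degree three at a vertex means that three of the four directions are used. `Inside` guarantees
that the integer points involved are vertices of the grid. -/
theorem nonSplitting_iff_sim {m n : ℕ} {P Q : PathIn (grid m n)} {L M : LShape}
    (hL : L.Inside m n) (hM : M.Inside m n) (hP : Traces P.walk L) (hQ : Traces Q.walk M) :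
    NonSplitting P Q ↔ L.Sim M := by
  have hset : ∀ v, {w | s(v, w) ∈ P.walk.edges ∨ s(v, w) ∈ Q.walk.edges} =
      {w : Fin m × Fin n | L.Edge v.1 v.2 w.1 w.2 ∨ M.Edge v.1 v.2 w.1 w.2} := fun v => by
    ext w
    simp only [Set.mem_ofPred_eq, hP v w, hQ v w]
  have hsplit : ∀ v, v ∈ splits P Q ↔ LShape.SplitAt L M v.1 v.2 := by
    intro v
    rw [mem_splits_iff, hset, ← Nat.lt_iff_add_one_le, Set.two_lt_ncard_iff (Set.toFinite _)]
    simp only [Set.mem_ofPred_eq]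
    constructor
    · rintro ⟨a, b, c, ha, hb, hc, hab, hac, hbc⟩
      have hne : ∀ {x y : Fin m × Fin n}, x ≠ y → (((x.1 : ℤ), (x.2 : ℤ)) : ℤ × ℤ) ≠
          (((y.1 : ℤ), (y.2 : ℤ)) : ℤ × ℤ) :=
        fun {x y} h h' => h (gridVertex_ext.2 ⟨congrArg Prod.fst h', congrArg Prod.snd h'⟩)
      refine three_of_directions (v := (v.1, v.2)) (hne hab) (hne hac) (hne hbc) ?_ ?_ ?_ <;>
      simp only [Prod.mk.injEq, and_assoc] <;>
      exact edge_direction (by assumption)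
    · have hE : L.H v.1 v.2 ∨ M.H v.1 v.2 → ∃ w : Fin m × Fin n, ((w.1 : ℤ) = v.1 + 1 ∧
          (w.2 : ℤ) = v.2) ∧ (L.Edge v.1 v.2 w.1 w.2 ∨ M.Edge v.1 v.2 w.1 w.2) := fun h => by
        have h1 := h.elim hL.of_H hM.of_H
        obtain ⟨w, h2, h3⟩ := exists_gridVertex (m := m) (n := n) (i := v.1 + 1) (j := v.2)
          (by omega) (by omega) (by omega) (by omega)
        refine ⟨w, ⟨h2, h3⟩, h.imp (fun h => ?_) (fun h => ?_)⟩ <;>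
        exact .inl ⟨h3.symm, .inl ⟨h2, h⟩⟩
      have hW : L.H (v.1 - 1) v.2 ∨ M.H (v.1 - 1) v.2 → ∃ w : Fin m × Fin n, ((w.1 : ℤ) = v.1 - 1 ∧
          (w.2 : ℤ) = v.2) ∧ (L.Edge v.1 v.2 w.1 w.2 ∨ M.Edge v.1 v.2 w.1 w.2) := fun h => by
        have h1 := h.elim hL.of_H hM.of_H
        obtain ⟨w, h2, h3⟩ := exists_gridVertex (m := m) (n := n) (i := v.1 - 1) (j := v.2)
          (by omega) (by omega) (by omega) (by omega)
        refine ⟨w, ⟨h2, h3⟩, h.imp (fun h => ?_) (fun h => ?_)⟩ <;>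
        exact .inl ⟨h3.symm, .inr ⟨by omega, by rwa [h2]⟩⟩
      have hN : L.U v.1 v.2 ∨ M.U v.1 v.2 → ∃ w : Fin m × Fin n, ((w.1 : ℤ) = v.1 ∧
          (w.2 : ℤ) = v.2 + 1) ∧ (L.Edge v.1 v.2 w.1 w.2 ∨ M.Edge v.1 v.2 w.1 w.2) := fun h => by
        have h1 := h.elim hL.of_U hM.of_U
        obtain ⟨w, h2, h3⟩ := exists_gridVertex (m := m) (n := n) (i := v.1) (j := v.2 + 1)
          (by omega) (by omega) (by omega) (by omega)
        refine ⟨w, ⟨h2, h3⟩, h.imp (fun h => ?_) (fun h => ?_)⟩ <;>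
        exact .inr ⟨h2.symm, .inl ⟨h3, h⟩⟩
      have hS : L.U v.1 (v.2 - 1) ∨ M.U v.1 (v.2 - 1) → ∃ w : Fin m × Fin n, ((w.1 : ℤ) = v.1 ∧
          (w.2 : ℤ) = v.2 - 1) ∧ (L.Edge v.1 v.2 w.1 w.2 ∨ M.Edge v.1 v.2 w.1 w.2) := fun h => by
        have h1 := h.elim hL.of_U hM.of_U
        obtain ⟨w, h2, h3⟩ := exists_gridVertex (m := m) (n := n) (i := v.1) (j := v.2 - 1)
          (by omega) (by omega) (by omega) (by omega)
        refine ⟨w, ⟨h2, h3⟩, h.imp (fun h => ?_) (fun h => ?_)⟩ <;>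
        exact .inr ⟨h2.symm, .inr ⟨by omega, by rwa [h3]⟩⟩
      have hthree : ∀ {a b c d e f : ℤ}, (∃ w : Fin m × Fin n, ((w.1 : ℤ) = a ∧ (w.2 : ℤ) = b) ∧
            (L.Edge v.1 v.2 w.1 w.2 ∨ M.Edge v.1 v.2 w.1 w.2)) →
          (∃ w : Fin m × Fin n, ((w.1 : ℤ) = c ∧ (w.2 : ℤ) = d) ∧
            (L.Edge v.1 v.2 w.1 w.2 ∨ M.Edge v.1 v.2 w.1 w.2)) →
          (∃ w : Fin m × Fin n, ((w.1 : ℤ) = e ∧ (w.2 : ℤ) = f) ∧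
            (L.Edge v.1 v.2 w.1 w.2 ∨ M.Edge v.1 v.2 w.1 w.2)) →
          ¬ (a = c ∧ b = d) → ¬ (a = e ∧ b = f) → ¬ (c = e ∧ d = f) →
          ∃ x y z : Fin m × Fin n, (L.Edge v.1 v.2 x.1 x.2 ∨ M.Edge v.1 v.2 x.1 x.2) ∧
            (L.Edge v.1 v.2 y.1 y.2 ∨ M.Edge v.1 v.2 y.1 y.2) ∧
            (L.Edge v.1 v.2 z.1 z.2 ∨ M.Edge v.1 v.2 z.1 z.2) ∧ x ≠ y ∧ x ≠ z ∧ y ≠ z := by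
        rintro a b c d e f ⟨x, ⟨rfl, rfl⟩, hx⟩ ⟨y, ⟨rfl, rfl⟩, hy⟩ ⟨z, ⟨rfl, rfl⟩, hz⟩ h1 h2 h3
        exact ⟨x, y, z, hx, hy, hz, fun h => h1 (gridVertex_ext.1 h),
          fun h => h2 (gridVertex_ext.1 h), fun h => h3 (gridVertex_ext.1 h)⟩
      rintro (⟨h1, h2, h3⟩ | ⟨h1, h2, h3⟩ | ⟨h1, h2, h3⟩ | ⟨h1, h2, h3⟩)
      · exact hthree (hE h1) (hW h2) (hN h3) (by omega) (by omega) (by omega)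
      · exact hthree (hE h1) (hW h2) (hS h3) (by omega) (by omega) (by omega)
      · exact hthree (hE h1) (hN h2) (hS h3) (by omega) (by omega) (by omega)
      · exact hthree (hW h1) (hN h2) (hS h3) (by omega) (by omega) (by omega)
  refine and_congr ⟨?_, ?_⟩ ⟨fun h i j hij => ?_, fun h => ?_⟩
  · rintro ⟨e, h1, h2⟩
    induction e with
    | _ x y =>
    rw [hP] at h1
    rw [hQ] at h2
    simp only [LShape.Edge] at h1 h2
    rcases h1 with ⟨h3, ⟨h4, h1⟩ | ⟨h4, h1⟩⟩ | ⟨h3, ⟨h4, h1⟩ | ⟨h4, h1⟩⟩ <;>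
    rcases h2 with ⟨h5, ⟨h6, h2⟩ | ⟨h6, h2⟩⟩ | ⟨h5, ⟨h6, h2⟩ | ⟨h6, h2⟩⟩ <;>
    first
    | exact .inl ⟨_, _, h1, h2⟩
    | exact .inr ⟨_, _, h1, h2⟩
    | omega
  · rintro (⟨i, j, h1, h2⟩ | ⟨i, j, h1, h2⟩)
    · have h3 := hL.of_H h1
      obtain ⟨x, rfl, rfl⟩ := exists_gridVertex (m := m) (n := n) (i := i) (j := j)
        (by omega) (by omega) (by omega) (by omega)
      obtain ⟨y, h4, h5⟩ := exists_gridVertex (m := m) (n := n) (i := x.1 + 1) (j := x.2)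
        (by omega) (by omega) (by omega) (by omega)
      exact ⟨s(x, y), (hP _ _).2 (.inl ⟨h5.symm, .inl ⟨h4, h1⟩⟩),
        (hQ _ _).2 (.inl ⟨h5.symm, .inl ⟨h4, h2⟩⟩)⟩
    · have h3 := hL.of_U h1
      obtain ⟨x, rfl, rfl⟩ := exists_gridVertex (m := m) (n := n) (i := i) (j := j)
        (by omega) (by omega) (by omega) (by omega)
      obtain ⟨y, h4, h5⟩ := exists_gridVertex (m := m) (n := n) (i := x.1) (j := x.2 + 1)
        (by omega) (by omega) (by omega) (by omega)
      exact ⟨s(x, y), (hP _ _).2 (.inr ⟨h4.symm, .inl ⟨h5, h1⟩⟩),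
        (hQ _ _).2 (.inr ⟨h4.symm, .inl ⟨h5, h2⟩⟩)⟩
  · have hb : 0 ≤ i ∧ i < m ∧ 0 ≤ j ∧ j < n := by
      rcases hij with ⟨h1 | h1, h2⟩ | ⟨h1 | h1, h2⟩ | ⟨h1 | h1, h2⟩ | ⟨h2, h1 | h1, h3⟩ <;>
      first
      | (have := hL.of_H h1; omega)
      | (have := hM.of_H h1; omega)
      | (have := hL.of_U h1; omega)
      | (have := hM.of_U h1; omega)
    obtain ⟨v, rfl, rfl⟩ := exists_gridVertex (m := m) (n := n) (i := i) (j := j)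
      (by omega) (by omega) (by omega) (by omega)
    have := (hsplit v).2 hij
    rw [h] at this
    exact this
  · exact Set.eq_empty_iff_forall_notMem.2 fun v hv => h _ _ ((hsplit v).1 hv)

/-- The clique lemmas also need the pairs with `a = b`, about which adjacency says nothing. A vertex
with any neighbour supplies them. -/
theorem LShape.Sim.self {P Q : LShape} (h : Sim P Q) : Sim P P := by
  refine ⟨h.1.imp (fun ⟨i, j, a, _⟩ => ⟨i, j, a, a⟩) (fun ⟨i, j, a, _⟩ => ⟨i, j, a, a⟩),
    fun i j h' => h.2 i j (Three.imp h' ?_ ?_ ?_ ?_)⟩ <;>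
  exact fun hh => .inl (or_self_iff.1 hh)

/-- The neighbourhoods in the clique of a split graph of one-bend paths. -/
theorem exists_cliqueTrace_of_isBENPG {V : Type*} [Finite V] {G : SimpleGraph V}
    (h : IsBENPG 1 G) {K S : Set V} (hsplit : IsSplitPartition G K S) :
    ∃ (l r : V → ℤ) (A B : ℤ), (∀ k ∈ K, l k ≤ 0 ∧ 1 ≤ r k) ∧
      ∀ s ∈ S, LShape.CliqueTrace K l r A B (G.Adj s) := by
  obtain ⟨m, n, P, rfl, hbend⟩ := h
  obtain ⟨hcompl, hK, -⟩ := hsplit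
  choose L hL hT using fun v => exists_shape (P v) (hbend v)
  have hadj : ∀ u v, (enpGraph P).Adj u v ↔ u ≠ v ∧ (L u).Sim (L v) := fun u v =>
    and_congr_right fun _ => nonSplitting_iff_sim (hL u) (hL v) (hT u) (hT v)
  by_cases hself : ∀ k ∈ K, (L k).Sim (L k)
  · obtain ⟨l, r, A, B, h1, h2⟩ := LShape.exists_cliqueTrace (L := L) (Set.toFinite K)
      fun a ha b hb => by
        by_cases hab : a = b
        · exact hab ▸ hself a ha
        · exact ((hadj a b).1 (hK ha hb hab)).2
    refine ⟨l, r, A, B, h1, fun s hs => ?_⟩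
    have key : ∀ k ∈ K, ((enpGraph P).Adj s k ↔ (L s).Sim (L k)) := fun k hk => by
      rw [hadj]
      exact and_iff_right fun hsk => hcompl.disjoint.le_bot ⟨hk, hsk ▸ hs⟩
    rcases h2 (L s) with ⟨a, b, h⟩ | ⟨a, b, h⟩ | ⟨b, h⟩ | ⟨a, h⟩
    · exact .inl ⟨a, b, fun k hk => (key k hk).trans (h k hk)⟩
    · exact .inr (.inl ⟨a, b, fun k hk => (key k hk).trans (h k hk)⟩)
    · exact .inr (.inr (.inl ⟨b, fun k hk => (key k hk).trans (h k hk)⟩))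
    · exact .inr (.inr (.inr ⟨a, fun k hk => (key k hk).trans (h k hk)⟩))
  -- A clique member not similar to itself has no neighbours. Hence it is all of `K`, and every
  -- trace is empty.
  · push Not at hself
    obtain ⟨c, hc, hcc⟩ := hself
    refine ⟨0, 1, 0, 0, by simp, fun s hs => .inl ⟨0, 0, fun k hk => iff_of_false (fun hsk => ?_) ?_⟩⟩
    · have hkc : k = c := by
        by_contra hne
        exact hcc ((hadj c k).1 (hK hc hk (Ne.symm hne))).2.self
      subst hkc
      exact hcc ((hadj s k).1 hsk).2.symm.self
    · simp

/-! ### Caterpillars -/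

/-- The caterpillar with a spine of `N` vertices `(i, none)` and, at each of them, a leaf
`(i, some c)` for every colour `c`. -/
def caterpillar (N : ℕ) (ι : Type*) : SimpleGraph (Fin N × Option ι) where
  Adj x y :=
    (x.2 = none ∧ y.2 = none ∧ ((y.1 : ℕ) = x.1 + 1 ∨ (x.1 : ℕ) = y.1 + 1)) ∨
    (x.1 = y.1 ∧ ((x.2 = none ∧ y.2 ≠ none) ∨ (x.2 ≠ none ∧ y.2 = none)))
  symm := ⟨by
    rintro x y (⟨h1, h2, h3⟩ | ⟨h1, h2⟩)
    · exact .inl ⟨h2, h1, h3.symm⟩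
    · exact .inr ⟨h1.symm, h2.symm.imp And.symm And.symm⟩⟩
  loopless := ⟨by
    rintro x (⟨-, -, h⟩ | ⟨-, ⟨h1, h2⟩ | ⟨h1, h2⟩⟩)
    · omega
    · exact h2 h1
    · exact h1 h2⟩

/-- A path of a caterpillar: an interval of the spine and possibly a leaf at its left end and
a leaf at its right end. -/
structure Hook (ι : Type*) where
  a : ℕ
  b : ℕ
  left : Option ι
  right : Option ι

namespace Hook

variable {ι : Type*} {N : ℕ}

/-- The leaf of colour `c` at the vertex `i` of the spine belongs to the path. -/
def Leaf (h : Hook ι) (i : ℕ) (c : ι) : Prop :=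
  (h.left = some c ∧ i = h.a) ∨ (h.right = some c ∧ i = h.b)

/-- The edges of the path. -/
def Edge (h : Hook ι) (x y : Fin N × Option ι) : Prop :=
  (x.2 = none ∧ y.2 = none ∧ h.a ≤ x.1 ∧ x.1 ≤ h.b ∧ h.a ≤ y.1 ∧ y.1 ≤ h.b ∧
    ((y.1 : ℕ) = x.1 + 1 ∨ (x.1 : ℕ) = y.1 + 1)) ∨
  (x.1 = y.1 ∧ ∃ c, h.Leaf x.1 c ∧ ((x.2 = none ∧ y.2 = some c) ∨ (x.2 = some c ∧ y.2 = none)))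

/-- The path exists in the caterpillar with a spine of `N` vertices. -/
structure Valid (N : ℕ) (h : Hook ι) : Prop where
  le : h.a ≤ h.b
  lt : h.b < N
  ne : h.a = h.b → h.left = none ∨ h.right = none

theorem exists_spine (a : ℕ) (b : ℕ) (hab : a ≤ b) (hb : b < N) :
    ∃ p : (caterpillar N ι).Walk (⟨a, by omega⟩, none) (⟨b, hb⟩, none), p.IsPath ∧
      (∀ x ∈ p.support, x.2 = none ∧ a ≤ x.1 ∧ x.1 ≤ b) ∧
      ∀ x y, s(x, y) ∈ p.edges ↔ (⟨a, b, none, none⟩ : Hook ι).Edge x y := by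
  induction b, hab using Nat.le_induction with
  | base =>
    refine ⟨.nil, by simp, by simp, fun x y => ?_⟩
    simp only [SimpleGraph.Walk.edges_nil, List.not_mem_nil, Edge, Leaf, false_iff]
    simp
    omega
  | succ b hab ih =>
    obtain ⟨p, h1, h2, h3⟩ := ih (by omega)
    have hadj : (caterpillar N ι).Adj (⟨b, by omega⟩, none) (⟨b + 1, hb⟩, none) :=
      .inl ⟨rfl, rfl, .inl rfl⟩
    refine ⟨p.concat hadj, ?_, ?_, ?_⟩
    · refine h1.concat (fun h => ?_) _
      have := (h2 _ h).2.2
      simp at this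
    · intro x hx
      rw [SimpleGraph.Walk.support_concat, List.mem_append, List.mem_singleton] at hx
      rcases hx with hx | rfl
      · have := h2 x hx
        exact ⟨this.1, this.2.1, by omega⟩
      · exact ⟨rfl, by dsimp only; omega, le_rfl⟩
    · rintro ⟨x, c⟩ ⟨y, d⟩
      rw [SimpleGraph.Walk.edges_concat, List.concat_eq_append, List.mem_append, h3,
        List.mem_singleton, Sym2.eq_iff]
      simp only [Edge, Leaf, Prod.mk.injEq, Fin.ext_iff, reduceCtorEq, false_and, or_self,
        exists_false, and_false, or_false]
      grind

theorem exists_walk_left {a b : ℕ} (hab : a ≤ b) (hb : b < N) (left : Option ι) :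
    ∃ (u : Fin N × Option ι) (p : (caterpillar N ι).Walk u (⟨b, hb⟩, none)), p.IsPath ∧
      (∀ x ∈ p.support, x.2 = none ∨ ((x.1 : ℕ) = a ∧ left ≠ none)) ∧
      ∀ x y, s(x, y) ∈ p.edges ↔ (⟨a, b, left, none⟩ : Hook ι).Edge x y := by
  obtain ⟨p, h1, h2, h3⟩ := exists_spine (N := N) (ι := ι) a b hab hb
  rcases left with - | c
  · exact ⟨_, p, h1, fun x hx => .inl (h2 x hx).1, h3⟩
  · have hadj : (caterpillar N ι).Adj (⟨a, by omega⟩, some c) (⟨a, by omega⟩, none) :=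
      .inr ⟨rfl, .inr ⟨by simp, rfl⟩⟩
    refine ⟨_, p.cons hadj, ?_, ?_, ?_⟩
    · rw [SimpleGraph.Walk.cons_isPath_iff]
      refine ⟨h1, fun h => ?_⟩
      have := (h2 _ h).1
      simp at this
    · intro x hx
      rw [SimpleGraph.Walk.support_cons, List.mem_cons] at hx
      rcases hx with rfl | hx
      · exact .inr ⟨rfl, by simp⟩
      · exact .inl (h2 x hx).1
    · rintro ⟨x, d⟩ ⟨y, e⟩
      rw [SimpleGraph.Walk.edges_cons, List.mem_cons, h3, Sym2.eq_iff]
      simp only [Edge, Leaf, Prod.mk.injEq, Fin.ext_iff, reduceCtorEq, false_and, or_self,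
        exists_false, and_false, or_false]
      grind

theorem exists_path {h : Hook ι} (hv : h.Valid N) :
    ∃ P : PathIn (caterpillar N ι), ∀ x y, s(x, y) ∈ P.walk.edges ↔ h.Edge x y := by
  obtain ⟨u, p, h1, h2, h3⟩ := exists_walk_left hv.le hv.lt h.left
  obtain ⟨a, b, left, right⟩ := h
  rcases right with - | c
  · exact ⟨⟨_, _, p, h1⟩, h3⟩
  · have hne : a = b → left = none := fun h => by simpa using hv.ne h
    have hadj : (caterpillar N ι).Adj (⟨b, hv.lt⟩, none) (⟨b, hv.lt⟩, some c) :=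
      .inr ⟨rfl, .inl ⟨rfl, by simp⟩⟩
    refine ⟨⟨_, _, p.concat hadj, h1.concat (fun h => ?_) _⟩, ?_⟩
    · rcases h2 _ h with h | h
      · simp at h
      · exact h.2 (hne h.1.symm)
    · rintro ⟨x, d⟩ ⟨y, e⟩
      dsimp only
      rw [SimpleGraph.Walk.edges_concat, List.concat_eq_append, List.mem_append, h3,
        List.mem_singleton, Sym2.eq_iff]
      simp only [Edge, Leaf, Prod.mk.injEq, Fin.ext_iff, reduceCtorEq, false_and, or_self,
        exists_false, and_false, or_false]
      grind (splits := 40)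

end Hook

/-! ### Criteria for splitting, and hooks in a caterpillar -/

theorem not_nonSplitting_of_three {W : Type*} [Finite W] {H : SimpleGraph W} {P Q : PathIn H}
    {v x y z : W} (hx : s(v, x) ∈ P.walk.edges ∨ s(v, x) ∈ Q.walk.edges)
    (hy : s(v, y) ∈ P.walk.edges ∨ s(v, y) ∈ Q.walk.edges)
    (hz : s(v, z) ∈ P.walk.edges ∨ s(v, z) ∈ Q.walk.edges) (hxy : x ≠ y) (hxz : x ≠ z)
    (hyz : y ≠ z) : ¬ NonSplitting P Q := by
  intro h
  have : v ∈ splits P Q := by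
    rw [mem_splits_iff, ← Nat.lt_iff_add_one_le, Set.two_lt_ncard_iff (Set.toFinite _)]
    exact ⟨x, y, z, hx, hy, hz, hxy, hxz, hyz⟩
  rw [h.2] at this
  exact this

theorem notMem_splits_of_two {W : Type*} {H : SimpleGraph W} {P Q : PathIn H} {v : W}
    (p q : W → Prop)
    (h : ∀ x, s(v, x) ∈ P.walk.edges ∨ s(v, x) ∈ Q.walk.edges → p x ∨ q x)
    (hp : ∀ x y, p x → p y → x = y) (hq : ∀ x y, q x → q y → x = y) : v ∉ splits P Q := by
  rw [mem_splits_iff]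
  intro h3
  -- Infinite sets have `ncard` zero, so the count of at least three already implies finiteness.
  have hfin := Set.finite_of_ncard_pos (lt_of_lt_of_le (by norm_num) h3)
  rw [← Nat.lt_iff_add_one_le, Set.two_lt_ncard_iff hfin] at h3
  obtain ⟨x, y, z, hx, hy, hz, hxy, hxz, hyz⟩ := h3
  rcases h x hx with h1 | h1 <;> rcases h y hy with h2 | h2 <;> rcases h z hz with h3 | h3
  · exact hxy (hp _ _ h1 h2)
  · exact hxy (hp _ _ h1 h2)
  · exact hxz (hp _ _ h1 h3)
  · exact hyz (hq _ _ h2 h3)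
  · exact hyz (hp _ _ h2 h3)
  · exact hxz (hq _ _ h1 h3)
  · exact hxy (hq _ _ h1 h2)
  · exact hxy (hq _ _ h1 h2)

namespace Hook

variable {ι : Type*} {N : ℕ}

theorem Edge.spine {h : Hook ι} {x y : Fin N} (h1 : h.a ≤ x) (h2 : (x : ℕ) ≤ h.b) (h3 : h.a ≤ y)
    (h4 : (y : ℕ) ≤ h.b) (h5 : (y : ℕ) = x + 1 ∨ (x : ℕ) = y + 1) :
    h.Edge (x, none) (y, none) :=
  .inl ⟨rfl, rfl, h1, h2, h3, h4, h5⟩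

theorem Edge.leaf {h : Hook ι} {x : Fin N} {c : ι} (hc : h.Leaf x c) :
    h.Edge (x, none) (x, some c) :=
  .inr ⟨rfl, c, hc, .inl ⟨rfl, rfl⟩⟩

/-- A spine interval and a hook. -/
theorem nonSplitting_iff {k h : Hook ι} {P Q : PathIn (caterpillar N ι)} [Finite ι]
    (hP : ∀ x y, s(x, y) ∈ P.walk.edges ↔ k.Edge x y)
    (hQ : ∀ x y, s(x, y) ∈ Q.walk.edges ↔ h.Edge x y)
    (hk : k.left = none ∧ k.right = none) (kv : k.Valid N) (hv : h.Valid N) :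
    NonSplitting P Q ↔ max k.a h.a < min k.b h.b ∧ (h.left ≠ none → h.a ≤ k.a) ∧
      (h.right ≠ none → k.b ≤ h.b) := by
  have hkb := kv.lt
  have hhb := hv.lt
  constructor
  · intro hs
    have hlt : max k.a h.a < min k.b h.b := by
      obtain ⟨⟨e, h1, h2⟩, -⟩ := hs
      induction e with
      | _ x y =>
      rw [hP] at h1
      rw [hQ] at h2
      simp only [Edge, Leaf, hk] at h1 h2
      grind (splits := 40)
    refine ⟨hlt, fun hl => ?_, fun hr => ?_⟩
    · obtain ⟨c, hc⟩ := Option.ne_none_iff_exists'.1 hl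
      by_contra hcon
      refine not_nonSplitting_of_three (v := (⟨h.a, by omega⟩, none))
        (x := (⟨h.a + 1, by omega⟩, none)) (y := (⟨h.a - 1, by omega⟩, none))
        (z := (⟨h.a, by omega⟩, some c)) (.inl ((hP _ _).2 ?_)) (.inl ((hP _ _).2 ?_))
        (.inr ((hQ _ _).2 ?_)) ?_ ?_ ?_ hs
      · apply Edge.spine <;> dsimp only <;> omega
      · apply Edge.spine <;> dsimp only <;> omega
      · exact Edge.leaf (.inl ⟨hc, rfl⟩)
      · simp only [ne_eq, Prod.mk.injEq, Fin.mk.injEq, and_true]; omega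
      · simp
      · simp
    · obtain ⟨c, hc⟩ := Option.ne_none_iff_exists'.1 hr
      by_contra hcon
      refine not_nonSplitting_of_three (v := (⟨h.b, by omega⟩, none))
        (x := (⟨h.b + 1, by omega⟩, none)) (y := (⟨h.b - 1, by omega⟩, none))
        (z := (⟨h.b, by omega⟩, some c)) (.inl ((hP _ _).2 ?_)) (.inl ((hP _ _).2 ?_))
        (.inr ((hQ _ _).2 ?_)) ?_ ?_ ?_ hs
      · apply Edge.spine <;> dsimp only <;> omega
      · apply Edge.spine <;> dsimp only <;> omega
      · exact Edge.leaf (.inr ⟨hc, rfl⟩)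
      · simp only [ne_eq, Prod.mk.injEq, Fin.mk.injEq, and_true]; omega
      · simp
      · simp
  · rintro ⟨hlt, hl, hr⟩
    refine ⟨⟨s((⟨max k.a h.a, by omega⟩, none), (⟨max k.a h.a + 1, by omega⟩, none)),
      (hP _ _).2 ?_, (hQ _ _).2 ?_⟩, Set.eq_empty_iff_forall_notMem.2 fun v => ?_⟩
    · apply Edge.spine <;> dsimp only <;> omega
    · apply Edge.spine <;> dsimp only <;> omega
    · obtain ⟨i, c⟩ := v
      rcases c with - | c
      -- At a spine vertex one neighbour lies on the left, along the spine or as the left leaf, and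
      -- one on the right. By `hl` and `hr` no leaf competes with a spine edge on its side.
      · refine notMem_splits_of_two
          (fun x => (x.2 = none ∧ (x.1 : ℕ) + 1 = i ∧ ((k.a < i ∧ i ≤ k.b) ∨ (h.a < i ∧ i ≤ h.b)))
            ∨ (h.left ≠ none ∧ (i : ℕ) = h.a ∧ x.1 = i ∧ x.2 = h.left))
          (fun x => (x.2 = none ∧ (i : ℕ) + 1 = x.1 ∧ ((k.a ≤ i ∧ i < k.b) ∨ (h.a ≤ i ∧ i < h.b)))
            ∨ (h.right ≠ none ∧ (i : ℕ) = h.b ∧ x.1 = i ∧ x.2 = h.right)) ?_ ?_ ?_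
        · rintro ⟨x, d⟩ hx
          rw [hP, hQ] at hx
          simp only [Edge, Leaf, hk] at hx
          grind (splits := 40)
        · rintro ⟨x, d⟩ ⟨y, e⟩ hx hy
          rw [Prod.ext_iff, Fin.ext_iff]
          dsimp only at hx hy ⊢
          grind (splits := 40)
        · rintro ⟨x, d⟩ ⟨y, e⟩ hx hy
          rw [Prod.ext_iff, Fin.ext_iff]
          dsimp only at hx hy ⊢
          grind (splits := 40)
      · refine notMem_splits_of_two (fun x => x = (i, none)) (fun x => False) ?_ ?_ ?_
        · rintro ⟨x, d⟩ hx
          rw [hP, hQ] at hx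
          simp only [Edge, Leaf, hk] at hx
          simp only [Prod.mk.injEq]
          grind (splits := 40)
        · rintro x y rfl rfl
          rfl
        · exact fun x y h => h.elim

/-- Two hooks that split whenever they meet. -/
theorem not_nonSplitting {h h' : Hook ι} {P Q : PathIn (caterpillar N ι)} [Finite ι]
    (hP : ∀ x y, s(x, y) ∈ P.walk.edges ↔ h.Edge x y)
    (hQ : ∀ x y, s(x, y) ∈ Q.walk.edges ↔ h'.Edge x y)
    (hv : h.Valid N) (hv' : h'.Valid N)
    (hleaf : ∀ i c, h.Leaf i c → ¬ h'.Leaf i c)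
    (hcase : h.b ≤ h'.a ∨ h'.b ≤ h.a ∨ (h.left ≠ none ∧ h'.left ≠ none) ∨
      (h.right ≠ none ∧ h'.right ≠ none)) : ¬ NonSplitting P Q := by
  intro hs
  have hb := hv.lt
  have hb' := hv'.lt
  -- No leaf is shared, so the common edge lies on the spine and the two intervals overlap.
  have hlt : max h.a h'.a < min h.b h'.b := by
    obtain ⟨⟨e, h1, h2⟩, -⟩ := hs
    induction e with
    | _ x y =>
    rw [hP] at h1
    rw [hQ] at h2
    rcases h1 with ⟨h1, h3, h4⟩ | ⟨h1, c, h3, h4⟩ <;>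
    rcases h2 with ⟨h2, h5, h6⟩ | ⟨h2, d, h5, h6⟩
    · omega
    · rcases h6 with ⟨h6, h7⟩ | ⟨h6, h7⟩ <;> simp_all
    · rcases h4 with ⟨h6, h7⟩ | ⟨h6, h7⟩ <;> simp_all
    · have : c = d := by rcases h4 with ⟨h6, h7⟩ | ⟨h6, h7⟩ <;> simp_all
      exact (hleaf _ _ h3 (this ▸ h5)).elim
  rcases hcase with h0 | h0 | ⟨hl, hl'⟩ | ⟨hr, hr'⟩
  · omega
  · omega
  · obtain ⟨c, hc⟩ := Option.ne_none_iff_exists'.1 hl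
    obtain ⟨d, hd⟩ := Option.ne_none_iff_exists'.1 hl'
    -- The left leaf further to the right is attached inside the other interval. If both are at the
    -- same vertex, two different leaves and a spine edge meet there.
    rcases lt_trichotomy h.a h'.a with h1 | h1 | h1
    · refine not_nonSplitting_of_three (v := (⟨h'.a, by omega⟩, none))
        (x := (⟨h'.a + 1, by omega⟩, none)) (y := (⟨h'.a - 1, by omega⟩, none))
        (z := (⟨h'.a, by omega⟩, some d)) (.inl ((hP _ _).2 ?_)) (.inl ((hP _ _).2 ?_))
        (.inr ((hQ _ _).2 ?_)) ?_ ?_ ?_ hs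
      · apply Edge.spine <;> dsimp only <;> omega
      · apply Edge.spine <;> dsimp only <;> omega
      · exact Edge.leaf (.inl ⟨hd, rfl⟩)
      · simp only [ne_eq, Prod.mk.injEq, Fin.mk.injEq, and_true]; omega
      · simp
      · simp
    · refine not_nonSplitting_of_three (v := (⟨h.a, by omega⟩, none))
        (x := (⟨h.a + 1, by omega⟩, none)) (y := (⟨h.a, by omega⟩, some c))
        (z := (⟨h.a, by omega⟩, some d)) (.inl ((hP _ _).2 ?_)) (.inl ((hP _ _).2 ?_))
        (.inr ((hQ _ _).2 ?_)) ?_ ?_ ?_ hs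
      · apply Edge.spine <;> dsimp only <;> omega
      · exact Edge.leaf (.inl ⟨hc, rfl⟩)
      · exact Edge.leaf (.inl ⟨hd, h1⟩)
      · simp
      · simp
      · rintro hcd
        simp only [Prod.mk.injEq, Option.some.injEq, true_and] at hcd
        exact hleaf h.a c (.inl ⟨hc, rfl⟩) (.inl ⟨hcd ▸ hd, h1⟩)
    · refine not_nonSplitting_of_three (v := (⟨h.a, by omega⟩, none))
        (x := (⟨h.a + 1, by omega⟩, none)) (y := (⟨h.a - 1, by omega⟩, none))
        (z := (⟨h.a, by omega⟩, some c)) (.inr ((hQ _ _).2 ?_)) (.inr ((hQ _ _).2 ?_))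
        (.inl ((hP _ _).2 ?_)) ?_ ?_ ?_ hs
      · apply Edge.spine <;> dsimp only <;> omega
      · apply Edge.spine <;> dsimp only <;> omega
      · exact Edge.leaf (.inl ⟨hc, rfl⟩)
      · simp only [ne_eq, Prod.mk.injEq, Fin.mk.injEq, and_true]; omega
      · simp
      · simp
  · obtain ⟨c, hc⟩ := Option.ne_none_iff_exists'.1 hr
    obtain ⟨d, hd⟩ := Option.ne_none_iff_exists'.1 hr'
    rcases lt_trichotomy h.b h'.b with h1 | h1 | h1
    · refine not_nonSplitting_of_three (v := (⟨h.b, by omega⟩, none))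
        (x := (⟨h.b + 1, by omega⟩, none)) (y := (⟨h.b - 1, by omega⟩, none))
        (z := (⟨h.b, by omega⟩, some c)) (.inr ((hQ _ _).2 ?_)) (.inr ((hQ _ _).2 ?_))
        (.inl ((hP _ _).2 ?_)) ?_ ?_ ?_ hs
      · apply Edge.spine <;> dsimp only <;> omega
      · apply Edge.spine <;> dsimp only <;> omega
      · exact Edge.leaf (.inr ⟨hc, rfl⟩)
      · simp only [ne_eq, Prod.mk.injEq, Fin.mk.injEq, and_true]; omega
      · simp
      · simp
    · refine not_nonSplitting_of_three (v := (⟨h.b, by omega⟩, none))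
        (x := (⟨h.b - 1, by omega⟩, none)) (y := (⟨h.b, by omega⟩, some c))
        (z := (⟨h.b, by omega⟩, some d)) (.inl ((hP _ _).2 ?_)) (.inl ((hP _ _).2 ?_))
        (.inr ((hQ _ _).2 ?_)) ?_ ?_ ?_ hs
      · apply Edge.spine <;> dsimp only <;> omega
      · exact Edge.leaf (.inr ⟨hc, rfl⟩)
      · exact Edge.leaf (.inr ⟨hd, h1⟩)
      · simp
      · simp
      · rintro hcd
        simp only [Prod.mk.injEq, Option.some.injEq, true_and] at hcd
        exact hleaf h.b c (.inr ⟨hc, rfl⟩) (.inr ⟨hcd ▸ hd, h1⟩)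
    · refine not_nonSplitting_of_three (v := (⟨h'.b, by omega⟩, none))
        (x := (⟨h'.b + 1, by omega⟩, none)) (y := (⟨h'.b - 1, by omega⟩, none))
        (z := (⟨h'.b, by omega⟩, some d)) (.inl ((hP _ _).2 ?_)) (.inl ((hP _ _).2 ?_))
        (.inr ((hQ _ _).2 ?_)) ?_ ?_ ?_ hs
      · apply Edge.spine <;> dsimp only <;> omega
      · apply Edge.spine <;> dsimp only <;> omega
      · exact Edge.leaf (.inr ⟨hd, rfl⟩)
      · simp only [ne_eq, Prod.mk.injEq, Fin.mk.injEq, and_true]; omega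
      · simp
      · simp

/-- A system of hooks that represents a split graph in a caterpillar. -/
theorem exists_representation [Finite ι] {V : Type*} {G : SimpleGraph V} {K S : Set V}
    (hsplit : IsSplitPartition G K S) (h : V → Hook ι) (hv : ∀ v, (h v).Valid N) (c : ℕ)
    (hK : ∀ k ∈ K, (h k).left = none ∧ (h k).right = none ∧ (h k).a ≤ c ∧ c < (h k).b)
    (hKS : ∀ k ∈ K, ∀ s ∈ S, (G.Adj s k ↔ max (h k).a (h s).a < min (h k).b (h s).b ∧
      ((h s).left ≠ none → (h s).a ≤ (h k).a) ∧ ((h s).right ≠ none → (h k).b ≤ (h s).b)))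
    (hS : ∀ s ∈ S, ∀ t ∈ S, s ≠ t → (∀ i c, (h s).Leaf i c → ¬ (h t).Leaf i c) ∧
      ((h s).b ≤ (h t).a ∨ (h t).b ≤ (h s).a ∨ ((h s).left ≠ none ∧ (h t).left ≠ none) ∨
      ((h s).right ≠ none ∧ (h t).right ≠ none))) :
    ∃ P : V → PathIn (caterpillar N ι), G = enpGraph P ∧
      ∀ v x y, s(x, y) ∈ (P v).walk.edges ↔ (h v).Edge x y := by
  choose P hP using fun v => exists_path (hv v)
  obtain ⟨hcompl, hclique, hindep⟩ := hsplit
  have hKS' : ∀ k ∈ K, ∀ s ∈ S, (G.Adj s k ↔ NonSplitting (P k) (P s)) := fun k hk s hs => by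
    rw [hKS k hk s hs, nonSplitting_iff (hP k) (hP s) ⟨(hK k hk).1, (hK k hk).2.1⟩ (hv k) (hv s)]
  refine ⟨P, ?_, hP⟩
  ext u v
  by_cases huv : u = v
  · subst huv
    exact iff_of_false (G.loopless.irrefl u) fun h => h.1 rfl
  have hmem : ∀ w, w ∈ K ∨ w ∈ S := fun w => by
    have : w ∈ K ⊔ S := hcompl.sup_eq_top ▸ Set.mem_univ w
    exact this
  change _ ↔ u ≠ v ∧ NonSplitting (P u) (P v)
  rw [and_iff_right huv]
  rcases hmem u with hu | hu <;> rcases hmem v with hv' | hv'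
  · refine iff_of_true (hclique hu hv' huv) ?_
    rw [nonSplitting_iff (hP u) (hP v) ⟨(hK u hu).1, (hK u hu).2.1⟩ (hv u) (hv v)]
    have h1 := hK u hu
    have h2 := hK v hv'
    exact ⟨by omega, fun h => absurd h2.1 h, fun h => absurd h2.2.1 h⟩
  · rw [G.adj_comm, hKS' u hu v hv']
  · rw [hKS' v hv' u hu]
    exact ⟨NonSplitting.symm, NonSplitting.symm⟩
  · refine iff_of_false (hindep hu hv' huv) ?_
    exact not_nonSplitting (hP u) (hP v) (hv u) (hv v) (hS u hu v hv' huv).1 (hS u hu v hv' huv).2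

end Hook

/-! ### Caterpillars as trees and as subgraphs of a grid -/

theorem caterpillar_isTree (N : ℕ) (hN : 0 < N) (ι : Type*) [Finite ι] :
    (caterpillar N ι).IsTree := by
  have hconn : (caterpillar N ι).Connected := by
    rw [SimpleGraph.connected_iff_exists_forall_reachable]
    refine ⟨(⟨0, hN⟩, none), ?_⟩
    have hspine : ∀ i : Fin N, (caterpillar N ι).Reachable (⟨0, hN⟩, none) (i, none) := fun i => by
      obtain ⟨p, -⟩ := Hook.exists_spine (N := N) (ι := ι) 0 i (Nat.zero_le _) i.2
      exact ⟨p⟩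
    rintro ⟨i, - | c⟩
    · exact hspine i
    · have hadj : (caterpillar N ι).Adj (i, none) (i, some c) := .inr ⟨rfl, .inl ⟨rfl, by simp⟩⟩
      exact (hspine i).trans hadj.reachable
  rw [SimpleGraph.isTree_iff_connected_and_card]
  refine ⟨hconn, le_antisymm ?_ hconn.card_vert_le_card_edgeSet_add_one⟩
  set root : Fin N × Option ι := (⟨0, hN⟩, none) with hroot
  -- Every edge joins a vertex other than the root to its parent, so there are fewer edges than
  -- vertices; a connected graph cannot have fewer than that. The value at the root is irrelevant.
  let parent : Fin N × Option ι → Fin N × Option ι := fun x =>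
    if x.2 = none then (⟨x.1 - 1, by omega⟩, none) else (x.1, none)
  have hsub : (caterpillar N ι).edgeSet ⊆ (fun x => s(x, parent x)) '' {root}ᶜ := by
    intro e
    induction e with
    | _ x y =>
    obtain ⟨i, c⟩ := x
    obtain ⟨j, d⟩ := y
    rw [SimpleGraph.mem_edgeSet]
    rintro (⟨h1, h2, h3 | h3⟩ | ⟨h1, ⟨h2, h3⟩ | ⟨h2, h3⟩⟩)
    · dsimp only at h1 h2 h3
      subst h1 h2
      refine ⟨(j, none), ?_, ?_⟩
      · simp only [Set.mem_compl_iff, Set.mem_singleton_iff, hroot, Prod.mk.injEq, Fin.ext_iff]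
        omega
      · dsimp only [parent]
        rw [if_pos rfl, Sym2.eq_swap]
        congr 3
        omega
    · dsimp only at h1 h2 h3
      subst h1 h2
      refine ⟨(i, none), ?_, ?_⟩
      · simp only [Set.mem_compl_iff, Set.mem_singleton_iff, hroot, Prod.mk.injEq, Fin.ext_iff]
        omega
      · dsimp only [parent]
        rw [if_pos rfl]
        congr 3
        omega
    · dsimp only at h1 h2 h3
      subst h1 h2
      refine ⟨(i, d), ?_, ?_⟩
      · simp [hroot, h3]
      · dsimp only [parent]
        rw [if_neg h3, Sym2.eq_swap]
    · dsimp only at h1 h2 h3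
      subst h1 h3
      refine ⟨(i, c), ?_, ?_⟩
      · simp [hroot, h2]
      · dsimp only [parent]
        rw [if_neg h2]
  have h1 : (caterpillar N ι).edgeSet.ncard ≤ ({root}ᶜ : Set (Fin N × Option ι)).ncard :=
    (Set.ncard_le_ncard hsub (Set.toFinite _)).trans (Set.ncard_image_le (Set.toFinite _))
  have h2 := Set.ncard_add_ncard_compl {root} (Set.toFinite _) (Set.toFinite _)
  rw [Set.ncard_singleton] at h2
  rw [Nat.card_coe_set_eq]
  omega

/-- The image of a path under an injective homomorphism. -/
def PathIn.map {W W' : Type*} {H : SimpleGraph W} {H' : SimpleGraph W'} (f : H →g H')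
    (hf : Function.Injective f) (P : PathIn H) : PathIn H' :=
  ⟨f P.source, f P.target, P.walk.map f, P.isPath.map hf⟩

section Map

variable {W W' : Type*} {H : SimpleGraph W} {H' : SimpleGraph W'} {f : H →g H'}
  (hf : Function.Injective f) (P Q : PathIn H)

theorem PathIn.mem_edges_map (x y : W') : s(x, y) ∈ (P.map f hf).walk.edges ↔
    ∃ a b, f a = x ∧ f b = y ∧ s(a, b) ∈ P.walk.edges := by
  simp only [PathIn.map, SimpleGraph.Walk.edges_map, List.mem_map]
  constructor
  · rintro ⟨e, he, h⟩
    induction e with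
    | _ a b =>
    rw [Sym2.map_mk, Sym2.eq_iff] at h
    rcases h with ⟨rfl, rfl⟩ | ⟨rfl, rfl⟩
    · exact ⟨a, b, rfl, rfl, he⟩
    · exact ⟨b, a, rfl, rfl, Sym2.eq_swap ▸ he⟩
  · rintro ⟨a, b, rfl, rfl, h⟩
    exact ⟨_, h, rfl⟩

/-- Common edges and splits depend only on the edges of the paths, so the embedding need not be
induced. Indeed, leaves of equal colour at consecutive spine vertices become adjacent in the grid.
-/
theorem nonSplitting_map_iff :
    NonSplitting (P.map f hf) (Q.map f hf) ↔ NonSplitting P Q := by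
  have hedge : ∀ (P : PathIn H) (a b : W), s(f a, f b) ∈ (P.map f hf).walk.edges ↔
      s(a, b) ∈ P.walk.edges := fun P a b => by
    rw [PathIn.mem_edges_map]
    constructor
    · rintro ⟨c, d, h1, h2, h3⟩
      rwa [← hf h1, ← hf h2]
    · exact fun h => ⟨a, b, rfl, rfl, h⟩
  have hsplit : ∀ v, f v ∈ splits (P.map f hf) (Q.map f hf) ↔ v ∈ splits P Q := fun v => by
    rw [mem_splits_iff, mem_splits_iff, ← Set.ncard_image_of_injective _ hf]
    suffices {w | s(f v, w) ∈ (P.map f hf).walk.edges ∨ s(f v, w) ∈ (Q.map f hf).walk.edges} =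
      f '' {w | s(v, w) ∈ P.walk.edges ∨ s(v, w) ∈ Q.walk.edges} by rw [this]
    ext w
    constructor
    · rintro (h | h)
      · obtain ⟨a, b, h1, rfl, h3⟩ := (P.mem_edges_map hf _ _).1 h
        exact ⟨b, .inl (hf h1 ▸ h3), rfl⟩
      · obtain ⟨a, b, h1, rfl, h3⟩ := (Q.mem_edges_map hf _ _).1 h
        exact ⟨b, .inr (hf h1 ▸ h3), rfl⟩
    · rintro ⟨b, h | h, rfl⟩
      · exact .inl ((hedge P _ _).2 h)
      · exact .inr ((hedge Q _ _).2 h)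
  refine and_congr ⟨?_, ?_⟩ ?_
  · rintro ⟨e, h1, h2⟩
    induction e with
    | _ x y =>
    obtain ⟨a, b, rfl, rfl, h⟩ := (P.mem_edges_map hf _ _).1 h1
    exact ⟨s(a, b), h, (hedge Q _ _).1 h2⟩
  · rintro ⟨e, h1, h2⟩
    induction e with
    | _ a b => exact ⟨s(f a, f b), (hedge P _ _).2 h1, (hedge Q _ _).2 h2⟩
  · simp only [Set.eq_empty_iff_forall_notMem]
    refine ⟨fun h v hv => h _ ((hsplit v).2 hv), fun h v hv => ?_⟩
    by_cases hr : ∃ u, f u = v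
    · obtain ⟨u, rfl⟩ := hr
      exact h u ((hsplit u).1 hv)
    · rw [mem_splits_iff] at hv
      have : {w | s(v, w) ∈ (P.map f hf).walk.edges ∨ s(v, w) ∈ (Q.map f hf).walk.edges} = ∅ := by
        refine Set.eq_empty_iff_forall_notMem.2 ?_
        rintro w (h | h)
        · obtain ⟨a, b, h1, -⟩ := (P.mem_edges_map hf _ _).1 h
          exact hr ⟨a, h1⟩
        · obtain ⟨a, b, h1, -⟩ := (Q.mem_edges_map hf _ _).1 h
          exact hr ⟨a, h1⟩
      rw [this, Set.ncard_empty] at hv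
      omega

theorem enpGraph_map {V : Type*} (P : V → PathIn H) :
    enpGraph (fun v => (P v).map f hf) = enpGraph P := by
  ext u v
  exact and_congr_right fun _ => nonSplitting_map_iff hf _ _

end Map

/-- The row of a vertex of the caterpillar with two colours in a grid with three rows. -/
def gridRow : Option Bool → Fin 3
  | none => 1
  | some true => 2
  | some false => 0

/-- The embedding of the caterpillar with two colours into a grid with three rows. -/
def caterpillarToGrid (N : ℕ) : caterpillar N Bool →g grid N 3 where
  toFun x := (x.1, gridRow x.2)
  map_rel' := by
    rintro ⟨i, c⟩ ⟨j, d⟩ (⟨h1, h2, h3⟩ | ⟨h1, h2⟩)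
    · rw [SimpleGraph.boxProd_adj, SimpleGraph.pathGraph_adj]
      dsimp only at *
      subst h1 h2
      exact .inl ⟨by omega, rfl⟩
    · rw [SimpleGraph.boxProd_adj]
      dsimp only at *
      subst h1
      refine .inr ⟨?_, rfl⟩
      rw [SimpleGraph.pathGraph_adj]
      rcases h2 with ⟨h2, h3⟩ | ⟨h2, h3⟩
      · subst h2
        rcases d with - | - | -
        · exact absurd rfl h3
        · decide
        · decide
      · subst h3
        rcases c with - | - | -
        · exact absurd rfl h2
        · decide
        · decide

theorem gridRow_injective : Function.Injective gridRow := by decide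

theorem caterpillarToGrid_injective (N : ℕ) : Function.Injective (caterpillarToGrid N) := by
  rintro ⟨i, c⟩ ⟨j, d⟩ h
  have h1 := congrArg Prod.fst h
  have h2 := congrArg Prod.snd h
  exact Prod.ext h1 (gridRow_injective h2)

/-- The spine is horizontal and only leaf edges are vertical, so a bend requires a leaf and occurs
at an end of the spine interval. -/
theorem ncard_bends_map_le {N : ℕ} {h : Hook Bool} (hv : h.Valid N)
    {P : PathIn (caterpillar N Bool)} (hP : ∀ x y, s(x, y) ∈ P.walk.edges ↔ h.Edge x y) :
    (bends (P.map (caterpillarToGrid N) (caterpillarToGrid_injective N))).ncard ≤ 2 := by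
  have hle := hv.le
  have hlt := hv.lt
  have hsub : bends (P.map (caterpillarToGrid N) (caterpillarToGrid_injective N)) ⊆
      {caterpillarToGrid N (⟨h.a, by omega⟩, none), caterpillarToGrid N (⟨h.b, hlt⟩, none)} := by
    rintro v ⟨x, y, hx, hy, hxv, hyv⟩
    rw [PathIn.mem_edges_map] at hx hy
    obtain ⟨x, u, rfl, rfl, hx⟩ := hx
    obtain ⟨y, u', rfl, hu, hy⟩ := hy
    obtain rfl := caterpillarToGrid_injective N hu
    rw [hP] at hx hy
    have hxv' : x.2 = u'.2 := gridRow_injective hxv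
    have hyv' : y.1 = u'.1 := hyv
    rcases hx with ⟨-, hnone, -⟩ | ⟨-, c, -, ⟨h1, h2⟩ | ⟨h1, h2⟩⟩
    · rcases hy with ⟨-, -, -, -, -, -, h3⟩ | ⟨h3, c, h4, -⟩
      · rw [hyv'] at h3
        omega
      · rw [h3] at h4
        have hu' : ∀ (i : Fin N), (u'.1 : ℕ) = i → u' = (i, none) := fun i hi =>
          Prod.ext (Fin.ext hi) hnone
        rcases h4 with ⟨-, h4⟩ | ⟨-, h4⟩
        · exact .inl (congrArg _ (hu' ⟨h.a, by omega⟩ h4))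
        · exact .inr (congrArg _ (hu' ⟨h.b, hlt⟩ h4))
    · simp [h1, h2] at hxv'
    · simp [h1, h2] at hxv'
  refine (Set.ncard_le_ncard hsub (Set.toFinite _)).trans ((Set.ncard_insert_le _ _).trans ?_)
  rw [Set.ncard_singleton]

/-! ### Split graphs of one-bend paths are graphs of paths in a tree -/

/-- The hook of a stable vertex with a given neighbourhood in the clique. -/
theorem exists_hook {ι V : Type*} {K : Set V} {l r : V → ℤ} {A B M : ℤ}
    (hK : ∀ k ∈ K, l k ≤ 0 ∧ 1 ≤ r k) (hM : ∀ v, -M ≤ l v ∧ r v ≤ M) (hM0 : 0 ≤ M)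
    {F : V → Prop} (hF : LShape.CliqueTrace K l r A B F) (c : ι) :
    ∃ h : Hook ι, h.Valid (2 * M + 10).toNat ∧ (∀ i d, h.Leaf i d → d = c) ∧
      ((h.left ≠ none ∧ h.b ≤ (M + 2).toNat) ∨ (h.right ≠ none ∧ (M + 2).toNat ≤ h.a) ∨
        (h.left ≠ none ∧ h.right ≠ none)) ∧
      ∀ k ∈ K, (F k ↔ max (l k + M + 1).toNat h.a < min (r k + M + 3).toNat h.b ∧
        (h.left ≠ none → h.a ≤ (l k + M + 1).toNat) ∧
        (h.right ≠ none → (r k + M + 3).toNat ≤ h.b)) := by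
  have both : (∃ a b, ∀ k ∈ K, (F k ↔ a ≤ l k ∧ r k ≤ b)) → ∃ h : Hook ι,
      h.Valid (2 * M + 10).toNat ∧ (∀ i d, h.Leaf i d → d = c) ∧
      ((h.left ≠ none ∧ h.b ≤ (M + 2).toNat) ∨ (h.right ≠ none ∧ (M + 2).toNat ≤ h.a) ∨
        (h.left ≠ none ∧ h.right ≠ none)) ∧
      ∀ k ∈ K, (F k ↔ max (l k + M + 1).toNat h.a < min (r k + M + 3).toNat h.b ∧
        (h.left ≠ none → h.a ≤ (l k + M + 1).toNat) ∧
        (h.right ≠ none → (r k + M + 3).toNat ≤ h.b)) := by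
    rintro ⟨a, b, h⟩
    -- Left ends are shifted by `M + 1` and right ends by `M + 3`, so every clique interval has the
    -- spine vertex `M + 2` in its interior. Hooks with one leaf stay on their side of it. The
    -- bounds are clamped to the range in which they matter on `K`, which keeps all positions
    -- natural and on the spine.
    refine ⟨⟨(min (max a (-M - 1)) 1 + M + 1).toNat, (max (min b (M + 1)) 0 + M + 3).toNat,
      some c, some c⟩, ⟨?_, ?_, ?_⟩, ?_, ?_, fun k hk => ?_⟩
    · dsimp only; omega
    · dsimp only; omega
    · dsimp only; omega
    · rintro i d (⟨h, -⟩ | ⟨h, -⟩) <;> exact (Option.some_injective _ h).symm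
    · exact .inr (.inr ⟨by simp, by simp⟩)
    · have h1 := hK k hk
      have h2 := hM k
      simp only [h k hk, ne_eq, reduceCtorEq, not_false_eq_true, true_imp_iff]
      omega
  rcases hF with ⟨a, b, h⟩ | ⟨a, b, h⟩ | ⟨b, h⟩ | ⟨a, h⟩
  · refine ⟨⟨(min (max a (-M - 1)) (max (min b 1) (-M - 1)) + M + 1).toNat,
      (max (min b 1) (-M - 1) + M + 1).toNat, some c, none⟩, ⟨?_, ?_, ?_⟩, ?_, ?_, fun k hk => ?_⟩
    · dsimp only; omega
    · dsimp only; omega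
    · simp
    · rintro i d (⟨h, -⟩ | ⟨h, -⟩)
      · exact (Option.some_injective _ h).symm
      · simp at h
    · exact .inl ⟨by simp, by dsimp only; omega⟩
    · have h1 := hK k hk
      have h2 := hM k
      simp only [h k hk, ne_eq, reduceCtorEq, not_false_eq_true, true_imp_iff, not_true_eq_false,
        false_imp_iff, and_true]
      omega
  · refine ⟨⟨(min (max a 0) (M + 1) + M + 3).toNat,
      (max (min b (M + 1)) (min (max a 0) (M + 1)) + M + 3).toNat, none, some c⟩, ⟨?_, ?_, ?_⟩,
      ?_, ?_, fun k hk => ?_⟩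
    · dsimp only; omega
    · dsimp only; omega
    · exact fun _ => .inl rfl
    · rintro i d (⟨h, -⟩ | ⟨h, -⟩)
      · simp at h
      · exact (Option.some_injective _ h).symm
    · exact .inr (.inl ⟨by simp, by dsimp only; omega⟩)
    · have h1 := hK k hk
      have h2 := hM k
      simp only [h k hk, ne_eq, reduceCtorEq, not_false_eq_true, true_imp_iff, not_true_eq_false,
        false_imp_iff, true_and]
      omega
  · exact both ⟨A, b, h⟩
  · exact both ⟨a, B, h⟩

/-- Stable vertices must be pairwise non-adjacent. Private colours prevent common leaf edges, and
any two hooks either lie on opposite sides of the centre or have leaves on the same side and split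
when they meet. -/
theorem isENPT_of_cliqueTrace {V : Type*} [Finite V] {G : SimpleGraph V} {K S : Set V}
    (hsplit : IsSplitPartition G K S) {l r : V → ℤ} {A B : ℤ}
    (hK : ∀ k ∈ K, l k ≤ 0 ∧ 1 ≤ r k)
    (hS : ∀ s ∈ S, LShape.CliqueTrace K l r A B (G.Adj s)) : IsENPT G := by
  classical
  obtain ⟨M, hM⟩ := (Set.finite_range fun v => max |l v| |r v|).bddAbove
  have hM' : ∀ v, -max M 0 ≤ l v ∧ r v ≤ max M 0 := fun v => by
    have h1 : max |l v| |r v| ≤ M := hM ⟨v, rfl⟩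
    have h2 := neg_abs_le (l v)
    have h3 := le_abs_self (r v)
    omega
  obtain ⟨M, hM, hM0⟩ : ∃ M : ℤ, (∀ v, -M ≤ l v ∧ r v ≤ M) ∧ 0 ≤ M := ⟨_, hM', le_max_right _ _⟩
  -- Colours are taken from `Fin (Nat.card V)` and not from `V`, because the host tree must live in
  -- `Type`.
  obtain ⟨e⟩ : Nonempty (V ≃ Fin (Nat.card V)) := ⟨Finite.equivFin V⟩
  have : Nonempty (Hook (Fin (Nat.card V))) := ⟨⟨0, 0, none, none⟩⟩
  have hex : ∀ v, v ∈ S → _ := fun v hv => exists_hook hK hM hM0 (hS v hv) (e v)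
  choose! g hg1 hg2 hg3 hg4 using hex
  have hKS : ∀ k ∈ K, k ∉ S := fun k hk hs => hsplit.1.disjoint.le_bot ⟨hk, hs⟩
  have hSK : ∀ v, v ∉ S → v ∈ K := fun v hv => by
    have : v ∈ K ⊔ S := hsplit.1.sup_eq_top ▸ Set.mem_univ v
    exact this.resolve_right hv
  let h : V → Hook (Fin (Nat.card V)) := fun v =>
    if v ∈ S then g v else ⟨(l v + M + 1).toNat, (r v + M + 3).toNat, none, none⟩
  have hs : ∀ s ∈ S, h s = g s := fun s hs => if_pos hs
  have hk : ∀ k ∈ K, h k = ⟨(l k + M + 1).toNat, (r k + M + 3).toNat, none, none⟩ :=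
    fun k hk => if_neg (hKS k hk)
  obtain ⟨P, hP, -⟩ := Hook.exists_representation (N := (2 * M + 10).toNat) hsplit h (fun v => by
      by_cases hv : v ∈ S
      · rw [hs v hv]
        exact hg1 v hv
      · rw [hk v (hSK v hv)]
        have h1 := hK v (hSK v hv)
        have h2 := hM v
        exact ⟨by dsimp only; omega, by dsimp only; omega, fun _ => .inl rfl⟩)
    (M + 2).toNat (fun k hkk => by
      rw [hk k hkk]
      have h1 := hK k hkk
      have h2 := hM k
      exact ⟨rfl, rfl, by dsimp only; omega, by dsimp only; omega⟩)
    (fun k hkk s hss => by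
      rw [hk k hkk, hs s hss]
      exact hg4 s hss k hkk)
    (fun s hss t htt hst => by
      rw [hs s hss, hs t htt]
      refine ⟨fun i c h1 h2 => hst (e.injective ((hg2 s hss i c h1).symm.trans
        (hg2 t htt i c h2))), ?_⟩
      have h1 := hg3 s hss
      have h2 := hg3 t htt
      rcases h1 with ⟨h1, h1'⟩ | ⟨h1, h1'⟩ | ⟨h1, h1'⟩ <;>
      rcases h2 with ⟨h2, h2'⟩ | ⟨h2, h2'⟩ | ⟨h2, h2'⟩
      · exact .inr (.inr (.inl ⟨h1, h2⟩))
      · exact .inl (h1'.trans h2')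
      · exact .inr (.inr (.inl ⟨h1, h2⟩))
      · exact .inr (.inl (h2'.trans h1'))
      · exact .inr (.inr (.inr ⟨h1, h2⟩))
      · exact .inr (.inr (.inr ⟨h1, h2'⟩))
      · exact .inr (.inr (.inl ⟨h1, h2⟩))
      · exact .inr (.inr (.inr ⟨h1', h2⟩))
      · exact .inr (.inr (.inl ⟨h1, h2⟩)))
  exact ⟨_, inferInstance, _, P, caterpillar_isTree _ (by omega) _, hP⟩

/-! ### The separating graph -/

theorem card_witnessPairs : witnessPairs.card = 23 := by decide +kernel

theorem not_isDiag_of_mem_witnessPairs : ∀ e ∈ witnessPairs, ¬ e.IsDiag := by decide +kernel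

/-- The paths that represent the stable vertices of the separating graph. -/
def pairHook (e : Sym2 (Fin 11)) : Hook Bool :=
  let i := (consecutivePairs sigmaL).idxOf e
  let j := (consecutivePairs sigmaR).idxOf e
  -- Each order has 10 consecutive pairs, and `idxOf` returns 10 for an absent one. A hook with one
  -- leaf selects the clique intervals whose ends are at positions `i`, `i + 1` of `sigmaL`, or `j`,
  -- `j + 1` of `sigmaR`. The last three hooks select by containment: the elements up to `2`, `3`,
  -- `4` that come no later than it in `sigmaR` are exactly that element and `0`. Their leaves use
  -- the second colour.
  if i < 10 then ⟨10 - i, 12 - i, some true, none⟩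
  else if j < 10 then ⟨12 + j, 14 + j, none, some true⟩
  else if e = s(0, 2) then ⟨9, 20, some false, some false⟩
  else if e = s(0, 3) then ⟨8, 18, some false, some false⟩
  else ⟨7, 16, some false, some false⟩

/-- The paths that represent the clique of the separating graph. -/
def cliqueHook (k : Fin 11) : Hook Bool := ⟨11 - k, 13 + sigmaR.idxOf k, none, none⟩

theorem cliqueHook_spec : ∀ k : Fin 11, (cliqueHook k).a ≤ 11 ∧ 11 < (cliqueHook k).b ∧
    (cliqueHook k).b < 27 := by decide +kernel

theorem pairHook_spec : ∀ e ∈ witnessPairs, (pairHook e).a < (pairHook e).b ∧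
    (pairHook e).b < 27 := by decide +kernel

theorem mem_pair_iff : ∀ e ∈ witnessPairs, ∀ k : Fin 11, k ∈ e ↔
    max (cliqueHook k).a (pairHook e).a < min (cliqueHook k).b (pairHook e).b ∧
      ((pairHook e).left ≠ none → (pairHook e).a ≤ (cliqueHook k).a) ∧
      ((pairHook e).right ≠ none → (cliqueHook k).b ≤ (pairHook e).b) := by decide +kernel

/-- The condition on stable vertices in `Hook.exists_representation`, with the quantifiers over
leaves eliminated so that it can be decided. -/
theorem pairHook_separated : ∀ e ∈ witnessPairs, ∀ f ∈ witnessPairs, e ≠ f →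
    (((pairHook e).left = (pairHook f).left → (pairHook e).left = none ∨
        (pairHook e).a ≠ (pairHook f).a) ∧
      ((pairHook e).left = (pairHook f).right → (pairHook e).left = none ∨
        (pairHook e).a ≠ (pairHook f).b) ∧
      ((pairHook e).right = (pairHook f).left → (pairHook e).right = none ∨
        (pairHook e).b ≠ (pairHook f).a) ∧
      ((pairHook e).right = (pairHook f).right → (pairHook e).right = none ∨
        (pairHook e).b ≠ (pairHook f).b)) ∧
    ((pairHook e).b ≤ (pairHook f).a ∨ (pairHook f).b ≤ (pairHook e).a ∨
      ((pairHook e).left ≠ none ∧ (pairHook f).left ≠ none) ∨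
      ((pairHook e).right ≠ none ∧ (pairHook f).right ≠ none)) := by decide +kernel

theorem witness_isSplitPartition : IsSplitPartition witnessGraph witnessK witnessS := by
  refine ⟨Set.isCompl_range_inl_range_inr, ?_, ?_⟩
  · rintro _ ⟨i, rfl⟩ _ ⟨j, rfl⟩ h
    exact fun hij => h (congrArg _ hij)
  · rintro _ ⟨i, rfl⟩ _ ⟨j, rfl⟩ _ h
    exact h

theorem exists_witness_representation : ∃ P : WitnessVertex → PathIn (caterpillar 27 Bool),
    witnessGraph = enpGraph P ∧ ∀ v, ∃ h : Hook Bool, h.Valid 27 ∧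
      ∀ x y, s(x, y) ∈ (P v).walk.edges ↔ h.Edge x y := by
  let h : WitnessVertex → Hook Bool := Sum.elim cliqueHook (fun e => pairHook e.1)
  have hv : ∀ v, (h v).Valid 27 := by
    rintro (k | ⟨e, he⟩)
    · have := cliqueHook_spec k
      exact ⟨by dsimp only [h, Sum.elim_inl]; omega, this.2.2, fun _ => .inl rfl⟩
    · have := pairHook_spec e he
      exact ⟨this.1.le, this.2, fun h => absurd h this.1.ne⟩
  obtain ⟨P, hP, hP'⟩ := Hook.exists_representation witness_isSplitPartition h hv 11
    (by
      rintro _ ⟨k, rfl⟩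
      exact ⟨rfl, rfl, (cliqueHook_spec k).1, (cliqueHook_spec k).2.1⟩)
    (by
      rintro _ ⟨k, rfl⟩ _ ⟨⟨e, he⟩, rfl⟩
      exact mem_pair_iff e he k)
    (by
      rintro _ ⟨⟨e, he⟩, rfl⟩ _ ⟨⟨f, hf⟩, rfl⟩ hne
      obtain ⟨⟨h1, h2, h3, h4⟩, h5⟩ := pairHook_separated e he f hf fun hef => hne (by
        subst hef
        rfl)
      refine ⟨?_, h5⟩
      rintro i c (⟨h6, rfl⟩ | ⟨h6, rfl⟩) (⟨h7, h8⟩ | ⟨h7, h8⟩)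
      · rcases h1 (h6.trans h7.symm) with h | h
        · exact Option.some_ne_none c (h6.symm.trans h)
        · exact h h8
      · rcases h2 (h6.trans h7.symm) with h | h
        · exact Option.some_ne_none c (h6.symm.trans h)
        · exact h h8
      · rcases h3 (h6.trans h7.symm) with h | h
        · exact Option.some_ne_none c (h6.symm.trans h)
        · exact h h8
      · rcases h4 (h6.trans h7.symm) with h | h
        · exact Option.some_ne_none c (h6.symm.trans h)
        · exact h h8)
  exact ⟨P, hP, fun v => ⟨h v, hv v, hP' v⟩⟩

theorem witness_isENPT : IsENPT witnessGraph := by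
  obtain ⟨P, hP, -⟩ := exists_witness_representation
  exact ⟨_, inferInstance, _, P, caterpillar_isTree 27 (by norm_num) Bool, hP⟩

theorem witness_isBENPG_two : IsBENPG 2 witnessGraph := by
  obtain ⟨P, hP, hP'⟩ := exists_witness_representation
  refine ⟨27, 3, fun v => (P v).map (caterpillarToGrid 27) (caterpillarToGrid_injective 27),
    by rw [enpGraph_map, hP], fun v => ?_⟩
  obtain ⟨h, hv, hh⟩ := hP' v
  exact ncard_bends_map_le hv hh

theorem witness_connected : witnessGraph.Connected := by
  rw [SimpleGraph.connected_iff_exists_forall_reachable]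
  have hK : ∀ i : Fin 11, witnessGraph.Reachable (.inl 0) (.inl i) := fun i => by
    by_cases h : 0 = i
    · rw [h]
    · exact SimpleGraph.Adj.reachable (show witnessGraph.Adj (.inl 0) (.inl i) from h)
  refine ⟨.inl 0, ?_⟩
  rintro (i | ⟨e, he⟩)
  · exact hK i
  · induction e with
    | _ x y =>
    refine (hK x).trans (SimpleGraph.Adj.reachable ?_)
    exact show x ∈ s(x, y) from Sym2.mem_mk_left x y

theorem ncard_witnessK : witnessK.ncard = 11 := by
  rw [witnessK, ← Set.image_univ, Set.ncard_image_of_injective _ Sum.inl_injective,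
    Set.ncard_univ, Nat.card_eq_fintype_card, Fintype.card_fin]

theorem ncard_witnessS : witnessS.ncard = 23 := by
  rw [witnessS, ← Set.image_univ, Set.ncard_image_of_injective _ Sum.inr_injective,
    Set.ncard_univ, Nat.card_eq_fintype_card, Fintype.card_coe, card_witnessPairs]

theorem ofDegree_two_witness : ofDegree witnessGraph witnessS 2 = witnessS := by
  refine Set.Subset.antisymm (fun v hv => hv.1) ?_
  rintro _ ⟨⟨e, he⟩, rfl⟩
  refine ⟨⟨_, rfl⟩, ?_⟩
  have hdiag := not_isDiag_of_mem_witnessPairs e he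
  have hset : witnessGraph.neighborSet (.inr ⟨e, he⟩) = Sum.inl '' {i | i ∈ e} := by
    ext (i | f)
    · rw [Sum.inl_injective.mem_set_image]
      exact Iff.rfl
    · refine iff_of_false (fun h => h) ?_
      rintro ⟨i, -, h⟩
      cases h
  rw [hset, Set.ncard_image_of_injective _ Sum.inl_injective]
  induction e with
  | _ x y =>
  have : {i | i ∈ s(x, y)} = {x, y} := by
    ext i
    simp
  rw [this, Set.ncard_pair (by simpa using hdiag)]

/-! ### Counting the pairs available to one-bend paths -/

/-- Pairs that are intervals with respect to a function are consecutive in a linear order, so that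
there are fewer of them than elements. -/
theorem card_interval_pairs {n : ℕ} (f : Fin (n + 1) → ℤ) (T : Finset (Sym2 (Fin (n + 1))))
    (hdiag : ∀ e ∈ T, ¬ e.IsDiag)
    (hT : ∀ e ∈ T, ∃ a b, ∀ k, k ∈ e ↔ a ≤ f k ∧ f k < b) : T.card ≤ n := by
  -- Ties of `f` are broken by the index, which gives a linear order.
  let g : Fin (n + 1) → ℤ ×ₗ Fin (n + 1) := fun k => toLex (f k, k)
  have hg : Function.Injective g := fun x y h => congrArg (fun z => (ofLex z).2) h
  have hgf : ∀ x y, g x ≤ g y → f x ≤ f y := fun x y h => by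
    rcases Prod.Lex.le_iff.1 h with h | h
    · exact h.le
    · exact h.1.le
  have hpair : ∀ e ∈ T, ∃ i j, e = s(i, j) ∧ g i < g j := by
    intro e he
    have hd := hdiag e he
    induction e with
    | _ x y =>
    rw [Sym2.mk_isDiag_iff] at hd
    rcases lt_trichotomy (g x) (g y) with h | h | h
    · exact ⟨x, y, rfl, h⟩
    · exact absurd (hg h) hd
    · exact ⟨y, x, Sym2.eq_swap, h⟩
  choose! i j hij hlt using hpair
  obtain ⟨m, -, hm⟩ := Finset.exists_max_image Finset.univ g ⟨0, Finset.mem_univ _⟩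
  -- A pair is determined by its smaller element: of two partners, the nearer one lies in the
  -- interval of the farther one, hence in that pair. The maximum `m` is never the smaller element,
  -- which saves one.
  have hinj : Set.InjOn i T := by
    have key : ∀ e ∈ T, ∀ e' ∈ T, i e = i e' → g (j e) ≤ g (j e') → e = e' := by
      intro e he e' he' h hle
      obtain ⟨a, b, hab⟩ := hT e' he'
      have h1 := Sym2.mem_mk_left (i e') (j e')
      have h2 := Sym2.mem_mk_right (i e') (j e')
      rw [← hij e' he', hab] at h1 h2
      have h3 : j e ∈ e' := (hab (j e)).2 ⟨h1.1.trans (hgf _ _ (h ▸ (hlt e he).le)),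
        (hgf _ _ hle).trans_lt h2.2⟩
      rw [hij e' he', Sym2.mem_iff] at h3
      rcases h3 with h3 | h3
      · exact absurd (h3.trans h.symm) (fun h4 => (hlt e he).ne (by rw [h4]))
      · rw [hij e he, hij e' he', h, h3]
    intro e he e' he' h
    rcases le_total (g (j e)) (g (j e')) with hle | hle
    · exact key e he e' he' h hle
    · exact (key e' he' e he h.symm hle).symm
  have hmaps : ∀ e ∈ T, i e ∈ Finset.univ.erase m := fun e he => by
    rw [Finset.mem_erase]
    refine ⟨fun h => ?_, Finset.mem_univ _⟩
    have h1 := hm (j e) (Finset.mem_univ _)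
    rw [← h] at h1
    exact absurd (hlt e he) (not_lt.2 h1)
  have := Finset.card_le_card_of_injOn i hmaps hinj
  rwa [Finset.card_erase_of_mem (Finset.mem_univ _), Finset.card_univ, Fintype.card_fin] at this

/-- Pairs that belong to a chain of sets coincide. -/
theorem card_chain_pairs {α : Type*} [DecidableEq α] (F : ℤ → α → Prop)
    (hF : ∀ b b', b ≤ b' → ∀ k, F b k → F b' k) (T : Finset (Sym2 α))
    (hdiag : ∀ e ∈ T, ¬ e.IsDiag) (hT : ∀ e ∈ T, ∃ b, ∀ k, k ∈ e ↔ F b k) : T.card ≤ 1 := by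
  have key : ∀ e ∈ T, ∀ e' ∈ T, ∀ b b', (∀ k, k ∈ e ↔ F b k) → (∀ k, k ∈ e' ↔ F b' k) →
      b ≤ b' → e = e' := by
    intro e he e' he' b b' hb hb' hle
    have hd := hdiag e he
    induction e with
    | _ x y =>
    rw [Sym2.mk_isDiag_iff] at hd
    have hx := (hb' x).2 (hF b b' hle x ((hb x).1 (by simp)))
    have hy := (hb' y).2 (hF b b' hle y ((hb y).1 (by simp)))
    exact ((Sym2.mem_and_mem_iff hd).1 ⟨hx, hy⟩).symm
  rw [Finset.card_le_one]
  intro e he e' he'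
  obtain ⟨b, hb⟩ := hT e he
  obtain ⟨b', hb'⟩ := hT e' he'
  rcases le_total b b' with h | h
  · exact key e he e' he' b b' hb hb' h
  · exact (key e' he' e he b' b hb' hb h).symm

/-- The four types of traces account for at most `10 + 10 + 1 + 1 = 22` pairs, while there are 23.
-/
theorem witness_not_isBENPG_one : ¬ IsBENPG 1 witnessGraph := by
  classical
  intro h
  obtain ⟨l, r, A, B, -, hS⟩ := exists_cliqueTrace_of_isBENPG h witness_isSplitPartition
  let T₁ := witnessPairs.filter fun e => ∃ a b, ∀ k, k ∈ e ↔ a ≤ l (.inl k) ∧ l (.inl k) < b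
  let T₂ := witnessPairs.filter fun e => ∃ a b, ∀ k, k ∈ e ↔ a ≤ r (.inl k) ∧ r (.inl k) < b
  let T₃ := witnessPairs.filter fun e => ∃ b, ∀ k, k ∈ e ↔ A ≤ l (.inl k) ∧ r (.inl k) ≤ b
  -- The parameter is negated so that the sets grow with it, as `card_chain_pairs` requires.
  let T₄ := witnessPairs.filter fun e => ∃ b, ∀ k, k ∈ e ↔ -b ≤ l (.inl k) ∧ r (.inl k) ≤ B
  have hcover : witnessPairs ⊆ T₁ ∪ T₂ ∪ T₃ ∪ T₄ := by
    intro e he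
    simp only [T₁, T₂, T₃, T₄, Finset.mem_union, Finset.mem_filter, he, true_and]
    have hmem : ∀ k, k ∈ e ↔ witnessGraph.Adj (.inr ⟨e, he⟩) (.inl k) := fun k => Iff.rfl
    rcases hS (.inr ⟨e, he⟩) ⟨_, rfl⟩ with ⟨a, b, h⟩ | ⟨a, b, h⟩ | ⟨b, h⟩ | ⟨a, h⟩
    · exact .inl (.inl (.inl ⟨a, b, fun k => (hmem k).trans (h _ ⟨k, rfl⟩)⟩))
    · exact .inl (.inl (.inr ⟨a + 1, b + 1, fun k => ((hmem k).trans (h _ ⟨k, rfl⟩)).trans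
        (by omega)⟩))
    · exact .inl (.inr ⟨b, fun k => (hmem k).trans (h _ ⟨k, rfl⟩)⟩)
    · exact .inr ⟨-a, fun k => ((hmem k).trans (h _ ⟨k, rfl⟩)).trans (by rw [neg_neg])⟩
  have hd : ∀ (p : Sym2 (Fin 11) → Prop), ∀ e ∈ witnessPairs.filter p, ¬ e.IsDiag := fun p e he =>
    not_isDiag_of_mem_witnessPairs e (Finset.mem_filter.1 he).1
  have h1 : T₁.card ≤ 10 := card_interval_pairs (fun k => l (.inl k)) T₁ (hd _) fun e he =>
    (Finset.mem_filter.1 he).2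
  have h2 : T₂.card ≤ 10 := card_interval_pairs (fun k => r (.inl k)) T₂ (hd _) fun e he =>
    (Finset.mem_filter.1 he).2
  have h3 : T₃.card ≤ 1 := card_chain_pairs (fun b k => A ≤ l (.inl k) ∧ r (.inl k) ≤ b)
    (fun b b' hb k hk => ⟨hk.1, hk.2.trans hb⟩) T₃ (hd _) fun e he => (Finset.mem_filter.1 he).2
  have h4 : T₄.card ≤ 1 := card_chain_pairs (fun b k => -b ≤ l (.inl k) ∧ r (.inl k) ≤ B)
    (fun b b' hb k hk => ⟨(neg_le_neg hb).trans hk.1, hk.2⟩) T₄ (hd _) fun e he =>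
      (Finset.mem_filter.1 he).2
  have h5 := Finset.card_le_card hcover
  rw [card_witnessPairs] at h5
  have h6 := Finset.card_union_le (T₁ ∪ T₂ ∪ T₃) T₄
  have h7 := Finset.card_union_le (T₁ ∪ T₂) T₃
  have h8 := Finset.card_union_le T₁ T₂
  omega

/-! ### Change of the universe -/

/-- Restricting the family of paths represents induced subgraphs. Applied to `ULift`, this moves
representations between universes in both directions. -/
theorem enpGraph_comap {V V' W : Type*} {H : SimpleGraph W} (P : V → PathIn H) {f : V' → V}
    (hf : Function.Injective f) : (enpGraph P).comap f = enpGraph (P ∘ f) := by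
  ext u v
  exact and_congr_left fun _ => hf.ne_iff

theorem IsBENPG.comap {V V' : Type*} {k : ℕ} {G : SimpleGraph V} (h : IsBENPG k G) {f : V' → V}
    (hf : Function.Injective f) : IsBENPG k (G.comap f) := by
  obtain ⟨m, n, P, rfl, hP⟩ := h
  exact ⟨m, n, P ∘ f, enpGraph_comap P hf, fun v => hP (f v)⟩

theorem IsENPT.comap {V V' : Type*} {G : SimpleGraph V} (h : IsENPT G) {f : V' → V}
    (hf : Function.Injective f) : IsENPT (G.comap f) := by
  obtain ⟨W, hW, T, P, hT, rfl⟩ := h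
  exact ⟨W, hW, T, P ∘ f, hT, enpGraph_comap P hf⟩

theorem IsSplitPartition.comap {V V' : Type*} {G : SimpleGraph V} {K S : Set V}
    (h : IsSplitPartition G K S) {f : V' → V} (hf : Function.Injective f) :
    IsSplitPartition (G.comap f) (f ⁻¹' K) (f ⁻¹' S) := by
  obtain ⟨h1, h2, h3⟩ := h
  refine ⟨h1.preimage f, fun u hu v hv huv => h2 hu hv (hf.ne huv),
    fun u hu v hv huv => h3 hu hv (hf.ne huv)⟩

/-- The separating graph in an arbitrary universe. -/
def liftedWitness : FinGraph.{u} :=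
  ⟨ULift.{u} WitnessVertex, inferInstance, witnessGraph.comap ULift.down⟩

theorem liftedWitness_mem_SPLIT : liftedWitness.{u} ∈ SPLIT.{u} :=
  ⟨_, _, witness_isSplitPartition.comap ULift.down_injective⟩

theorem liftedWitness_notMem_BENPG_one : liftedWitness.{u} ∉ BENPG.{u} 1 := fun h =>
  witness_not_isBENPG_one (IsBENPG.comap (f := ULift.up.{u}) h ULift.up_injective)

theorem BENPG_one_subset_two : BENPG.{u} 1 ⊆ BENPG.{u} 2 := by
  rintro G ⟨m, n, P, hP, hb⟩
  exact ⟨m, n, P, hP, fun v => (hb v).trans one_le_two⟩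

theorem BENPG_one_inter_SPLIT_subset_ENPT : BENPG.{u} 1 ∩ SPLIT.{u} ⊆ ENPT.{u} := by
  rintro G ⟨h1, K, S, hKS⟩
  have := G.finite
  obtain ⟨l, r, A, B, hK, hS⟩ := exists_cliqueTrace_of_isBENPG h1 hKS
  exact isENPT_of_cliqueTrace hKS hK hS

end ENP

theorem mainTheorem4 :
    (ENP.BENPG.{u} 1 ∩ ENP.SPLIT.{u} ⊂ ENP.BENPG.{u} 2 ∩ ENP.SPLIT.{u}) ∧
    (ENP.BENPG.{u} 1 ∩ ENP.SPLIT.{u} ⊂ ENP.ENPT.{u} ∩ ENP.SPLIT.{u}) ∧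
    -- the separating graph
    (ENP.IsSplitPartition ENP.witnessGraph ENP.witnessK ENP.witnessS ∧
      ENP.witnessGraph.Connected ∧
      ENP.witnessK.ncard = 11 ∧ ENP.witnessS.ncard = 23 ∧
      2 * ((ENP.witnessK.ncard : ℤ) + 2 - 2) <
        ((ENP.ofDegree ENP.witnessGraph ENP.witnessS 2).ncard : ℤ) ∧
      ENP.witness ∈ ENP.BENPG 2 ∩ ENP.SPLIT ∧
      ENP.witness ∈ ENP.ENPT ∩ ENP.SPLIT ∧
      ENP.witness ∉ ENP.BENPG 1) := by
  refine ⟨?_, ?_, ENP.witness_isSplitPartition, ENP.witness_connected, ENP.ncard_witnessK,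
    ENP.ncard_witnessS, ?_, ⟨ENP.witness_isBENPG_two, _, _, ENP.witness_isSplitPartition⟩,
    ⟨ENP.witness_isENPT, _, _, ENP.witness_isSplitPartition⟩, ENP.witness_not_isBENPG_one⟩
  · rw [Set.ssubset_iff_of_subset (Set.inter_subset_inter_left _ ENP.BENPG_one_subset_two)]
    exact ⟨ENP.liftedWitness, ⟨ENP.witness_isBENPG_two.comap ULift.down_injective,
      ENP.liftedWitness_mem_SPLIT⟩, fun h => ENP.liftedWitness_notMem_BENPG_one h.1⟩
  · rw [Set.ssubset_iff_of_subset (Set.subset_inter ENP.BENPG_one_inter_SPLIT_subset_ENPT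
      Set.inter_subset_right)]
    exact ⟨ENP.liftedWitness, ⟨ENP.witness_isENPT.comap ULift.down_injective,
      ENP.liftedWitness_mem_SPLIT⟩, fun h => ENP.liftedWitness_notMem_BENPG_one h.1⟩
  · rw [ENP.ofDegree_two_witness, ENP.ncard_witnessK, ENP.ncard_witnessS]
    norm_num
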